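/- Let $\lambda>0$ and let $N=(N(t))_{t\ge 0}$ be a Poisson process with rate $\lambda$ on a probability space: $N(0)=0$, the paths are $\mathbb{N}$-valued, nondecreasing and right-continuous, increments are independent, and $N(t)-N(s)\sim\mathrm{Poisson}(\lambda(t-s))$ for $s\le t$. Let $\mathcal{G}_t=\sigma(N(s):0\le s\le t)$ and $W(t)=\int_0^t N(u)\,du$. (i) The process $\left\{W(t)-\frac{1}{2\lambda}N(t)^2+\frac{1}{2\lambda}N(t)\right\}_{t\ge0}$ is a martingale with respect to $\{\mathcal{G}_t\}$. (ii) For every $\{\mathcal{G}_t\}$-stopping time $\tau$ with $\mathbb{E}[\tau]<\infty$, $$\mathbb{E}[W(\tau)]=\frac{1}{2\lambda}\mathbb{E}[N(\tau)^2-N(\tau)],\qquad \mathbb{E}[\tau]=\frac{1}{\lambda}\mathbb{E}[N(\tau)],$$ where the two sides of the first identity may both be $+\infty$. (iii) For a clearing policy with release time $\tau$, let $AOD_\tau=\mathbb{E}[W(\tau)]/\mathbb{E}[N(\tau)]$ be the average order delay, i.e. the mean cumulative waiting per cycle divided by the mean number of orders arriving in a cycle. For every $\{\mathcal{G}_t\}$-stopping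 time $\tau$ with $0<\mathbb{E}[\tau]<\infty$, $$AOD_\tau=\frac{\mathbb{E}[W(\tau)]}{\lambda\,\mathbb{E}[\tau]}=\frac{\mathbb{E}[N(\tau)^2-N(\tau)]/(2\lambda)}{\mathbb{E}[N(\tau)]}.$$ (iv) Let $q\ge1$ be an integer and $T>0$, let $\tau_q=\inf\{t\ge 0: N(t)\ge q\}$ be the arrival time of the $q$-th order, let $Y\sim\mathrm{Poisson}(\lambda T)$, and write $Y_k=\min(Y,k)$ for integers $k\ge0$ and $a\wedge b=\min(a,b)$. Each of the following release times $\tau$ is a $\{\mathcal{G}_t\}$-stopping time, and the expected cumulative waiting, expected cycle length and average order delay are as listed: - QP, $\tau=\tau_q$: $\ \mathbb{E}[W(\tau)]=\frac{q(q-1)}{2\lambda}$, $\ \mathbb{E}[\tau]=\frac{q}{\lambda}$, $\ AOD_{QP}=\frac{q-1}{2\lambda}$. - TP1, $\tau=T$: $\ \mathbb{E}[W(\tau)]=\frac{\lambda T^2}{2}$, $\ \mathbb{E}[\tau]=T$, $\ AOD_{TP1}=\frac{T}{2}$. - TP2, $\tau=\tau_1+T$: $\ \mathbb{E}[W(\tau)]=\frac{\lambda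 T^2}{2}+T$, $\ \mathbb{E}[\tau]=\frac1\lambda+T$, $\ AOD_{TP2}=\frac{T+\lambda T^2/2}{1+\lambda T}$. - HP1, $\tau=\tau_q\wedge T$: $\ \mathbb{E}[W(\tau)]=\frac{\mathbb{E}[Y_q(Y_q-1)]}{2\lambda}$, $\ \mathbb{E}[\tau]=\frac{\mathbb{E}[Y_q]}{\lambda}$, $\ AOD_{HP1}=\frac{\mathbb{E}[Y_q(Y_q-1)]/(2\lambda)}{\mathbb{E}[Y_q]}$. - HP2, $\tau=\tau_q\wedge(\tau_1+T)$: $\ \mathbb{E}[W(\tau)]=\frac{\mathbb{E}[Y_{q-1}(Y_{q-1}+1)]}{2\lambda}$, $\ \mathbb{E}[\tau]=\frac{\mathbb{E}[Y_{q-1}+1]}{\lambda}$, $\ AOD_{HP2}=\frac{\mathbb{E}[Y_{q-1}(Y_{q-1}+1)]/(2\lambda)}{\mathbb{E}[Y_{q-1}+1]}$. -/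

import Mathlib

open MeasureTheory ProbabilityTheory
open scoped NNReal ENNReal

/-- A (homogeneous) Poisson process with rate `lam`: a counting process started at `0`, with
nondecreasing right-continuous paths, independent increments, and increments over `(s, t]` that
are Poisson distributed with parameter `lam * (t - s)`. The paths are nondecreasing, so the
natural-number differences below are true differences. -/
structure IsPoissonProcess {Ω : Type*} [MeasurableSpace Ω] (N : ℝ≥0 → Ω → ℕ) (lam : ℝ≥0)
    (P : Measure Ω) : Prop where
  measurable : ∀ t, Measurable (N t)
  zero : ∀ ω, N 0 ω = 0
  mono : ∀ ω, Monotone fun t => N t ω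
  rightCts : ∀ ω t, ContinuousWithinAt (fun u => N u ω) (Set.Ici t) t
  indepIncrements : HasIndepIncrements N P
  law_increment : ∀ s t, s ≤ t →
    HasLaw (fun ω => N t ω - N s ω) (poissonMeasure (lam * (t - s))) P

/-- The natural filtration of the process, `𝒢 t = σ(N s, s ≤ t)`. -/
def IsPoissonProcess.filtration {Ω : Type*} [mΩ : MeasurableSpace Ω] {N : ℝ≥0 → Ω → ℕ}
    {lam : ℝ≥0} {P : Measure Ω} (hN : IsPoissonProcess N lam P) : Filtration ℝ≥0 mΩ :=
  Filtration.natural N fun t => (hN.measurable t).stronglyMeasurable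

/-- Cumulative waiting `W(t) = ∫₀ᵗ N(u) du`. -/
noncomputable def cumulativeWaiting {Ω : Type*} (N : ℝ≥0 → Ω → ℕ) (t : ℝ≥0) (ω : Ω) : ℝ :=
  ∫ u in (0 : ℝ)..(t : ℝ), (N u.toNNReal ω : ℝ)

/-- The mean `E[τ] ∈ [0, ∞]` of the cycle length. -/
noncomputable def meanCycle {Ω : Type*} [MeasurableSpace Ω] (P : Measure Ω)
    (τ : Ω → ℝ≥0∞) : ℝ≥0∞ :=
  ∫⁻ ω, τ ω ∂P

/-- `E[W(τ)] ∈ [0, ∞]`. -/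
noncomputable def meanWaiting {Ω : Type*} [MeasurableSpace Ω] (P : Measure Ω)
    (N : ℝ≥0 → Ω → ℕ) (τ : Ω → ℝ≥0∞) : ℝ≥0∞ :=
  ∫⁻ ω, ENNReal.ofReal (stoppedValue (cumulativeWaiting N) τ ω) ∂P

/-- `E[N(τ)] ∈ [0, ∞]`, the mean number of orders arriving in a cycle. -/
noncomputable def meanOrders {Ω : Type*} [MeasurableSpace Ω] (P : Measure Ω)
    (N : ℝ≥0 → Ω → ℕ) (τ : Ω → ℝ≥0∞) : ℝ≥0∞ :=
  ∫⁻ ω, ((stoppedValue N τ ω : ℕ) : ℝ≥0∞) ∂P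

/-- `E[N(τ)² - N(τ)] ∈ [0, ∞]`; the integrand is nonnegative since `N` takes values in `ℕ`. -/
noncomputable def meanOrdersSqSub {Ω : Type*} [MeasurableSpace Ω] (P : Measure Ω)
    (N : ℝ≥0 → Ω → ℕ) (τ : Ω → ℝ≥0∞) : ℝ≥0∞ :=
  ∫⁻ ω, ENNReal.ofReal (((stoppedValue N τ ω : ℕ) : ℝ) ^ 2 - ((stoppedValue N τ ω : ℕ) : ℝ)) ∂P

/-- Average order delay of the clearing policy with release time `τ`: the mean cumulative waiting
per cycle divided by the mean number of orders arriving in a cycle. -/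
noncomputable def averageOrderDelay {Ω : Type*} [MeasurableSpace Ω] (P : Measure Ω)
    (N : ℝ≥0 → Ω → ℕ) (τ : Ω → ℝ≥0∞) : ℝ≥0∞ :=
  meanWaiting P N τ / meanOrders P N τ

/-- The arrival time of the `q`-th order, the first `t` with `q ≤ N t` (`∞` if there is none). -/
noncomputable def arrivalTime {Ω : Type*} (N : ℝ≥0 → Ω → ℕ) (q : ℕ) : Ω → ℝ≥0∞ :=
  hittingAfter N (Set.Ici q) 0

/-- Quantity-based policy: release at the `q`-th order. -/
noncomputable def policyQP {Ω : Type*} (N : ℝ≥0 → Ω → ℕ) (q : ℕ) : Ω → ℝ≥0∞ :=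
  arrivalTime N q

/-- Time-based policy 1: release after `T` units of time. -/
def policyTP1 (Ω : Type*) (T : ℝ≥0) : Ω → ℝ≥0∞ :=
  fun _ => (T : ℝ≥0∞)

/-- Time-based policy 2: release `T` units of time after the first order. -/
noncomputable def policyTP2 {Ω : Type*} (N : ℝ≥0 → Ω → ℕ) (T : ℝ≥0) : Ω → ℝ≥0∞ :=
  fun ω => arrivalTime N 1 ω + (T : ℝ≥0∞)

/-- Hybrid policy 1: release at the `q`-th order or at time `T`, whichever is first. -/
noncomputable def policyHP1 {Ω : Type*} (N : ℝ≥0 → Ω → ℕ) (q : ℕ) (T : ℝ≥0) : Ω → ℝ≥0∞ :=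
  fun ω => min (arrivalTime N q ω) (T : ℝ≥0∞)

/-- Hybrid policy 2: release at the `q`-th order or `T` units of time after the first order,
whichever is first. -/
noncomputable def policyHP2 {Ω : Type*} (N : ℝ≥0 → Ω → ℕ) (q : ℕ) (T : ℝ≥0) : Ω → ℝ≥0∞ :=
  fun ω => min (arrivalTime N q ω) (arrivalTime N 1 ω + (T : ℝ≥0∞))

/-- `E[f(Y ∧ k)]` for `Y` Poisson distributed with parameter `r`. -/
noncomputable def truncPoissonMean (r : ℝ≥0) (k : ℕ) (f : ℝ → ℝ) : ℝ :=
  ∫ y, f ((min y k : ℕ) : ℝ) ∂(poissonMeasure r)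

/-! Given the past up to `s`, the increment `D = N t - N s` is an independent Poisson variable of
mean `λ(t-s)`, and `N t (N t - 1) = N s (N s - 1) + 2 N s D + D (D - 1)`. Hence `N(N-1)` drifts by
`2λ(t-s) N s + (λ(t-s))²`. By Fubini `W` drifts by `(t-s) N s + λ(t-s)²/2`, which is the same
quantity divided by `2λ`. So both `W - N(N-1)/(2λ)` and `N - λt` are martingales.

Optional stopping is applied to them at `min τ n`, where the paths are dominated by an integrable
variable. Continuous time is reduced to countably many values by rounding `τ` up to a grid and using
right-continuity (`Martingale.integral_stoppedValue_of_rightCts`). Since `W`, `N` and `N² - N` are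
nonnegative and nondecreasing in time, monotone convergence removes the truncation in `[0, ∞]`
without uniform integrability (`meanOrders_eq`, `meanWaiting_eq`).

For each policy it then suffices to know the law of `N(τ)`. Two facts give it: almost surely all
jumps have height one, so `N(τ_q) = q` (`ae_natCast_arrivalTime`), and the increment after a
stopping time is still Poisson (`hasLaw_increment_stoppingTime`). Thus `N(τ)` is an explicit
function of one Poisson variable (`policy_means`). -/

section

open Filter Topology

/-! ### Approximation of times from the right by a grid. -/

/-- The smallest point of the grid `ℕ / (n + 1)` that is at least `u`. -/
noncomputable def ceilGrid (n : ℕ) (u : ℝ≥0) : ℝ≥0 := (⌈(n + 1 : ℝ≥0) * u⌉₊ : ℝ≥0) / (n + 1)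

theorem le_ceilGrid (n : ℕ) (u : ℝ≥0) : u ≤ ceilGrid n u := by
  rw [ceilGrid, le_div_iff₀ (by positivity), mul_comm]
  exact Nat.le_ceil _

theorem ceilGrid_le (n : ℕ) (u : ℝ≥0) : ceilGrid n u ≤ u + 1 / (n + 1) := by
  rw [ceilGrid, div_le_iff₀ (by positivity), add_mul u, one_div_mul_cancel (by positivity), mul_comm u]
  exact (Nat.ceil_lt_add_one (by positivity)).le

theorem ceilGrid_le_add_one (n : ℕ) (u : ℝ≥0) : ceilGrid n u ≤ u + 1 := by
  refine (ceilGrid_le n u).trans (add_le_add_right ?_ u)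
  rw [div_le_one (by positivity)]
  exact le_add_self

/-- The bound on the right is the last grid point not after `t`; this is why rounding a stopping
time up gives a stopping time. -/
theorem ceilGrid_le_iff (n : ℕ) (u t : ℝ≥0) :
    ceilGrid n u ≤ t ↔ u ≤ (⌊(n + 1 : ℝ≥0) * t⌋₊ : ℝ≥0) / (n + 1) := by
  rw [ceilGrid, div_le_iff₀ (by positivity), mul_comm t, ← Nat.le_floor_iff (by positivity),
    Nat.ceil_le, le_div_iff₀ (by positivity), mul_comm]

theorem tendsto_ceilGrid (u : ℝ≥0) : Tendsto (fun n => ceilGrid n u) atTop (𝓝[≥] u) := by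
  refine tendsto_nhdsWithin_iff.2 ⟨?_, .of_forall fun n => le_ceilGrid n u⟩
  refine tendsto_of_tendsto_of_tendsto_of_le_of_le tendsto_const_nhds ?_
    (fun n => le_ceilGrid n u) (fun n => ceilGrid_le n u)
  simpa using tendsto_const_nhds.add (tendsto_one_div_add_atTop_nhds_zero_nat (𝕜 := ℝ≥0))

theorem measurable_ceilGrid (n : ℕ) : Measurable (ceilGrid n) := by
  unfold ceilGrid
  fun_prop

/-- A process with right-continuous paths is jointly measurable. -/
theorem measurable_uncurry_of_rightCts {Ω E : Type*} [MeasurableSpace Ω] [TopologicalSpace E]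
    [TopologicalSpace.PseudoMetrizableSpace E] [MeasurableSpace E] [BorelSpace E]
    {X : ℝ≥0 → Ω → E} (hX : ∀ t, Measurable (X t))
    (hc : ∀ ω t, ContinuousWithinAt (fun u => X u ω) (Set.Ici t) t) :
    Measurable (fun p : ℝ≥0 × Ω => X p.1 p.2) := by
  have hlim : ∀ p : ℝ≥0 × Ω, Tendsto (fun n => X (ceilGrid n p.1) p.2) atTop (𝓝 (X p.1 p.2)) :=
    fun p => Tendsto.comp (g := fun u => X u p.2) (hc p.2 p.1) (tendsto_ceilGrid p.1)
  refine measurable_of_tendsto_metrizable (f := fun n (p : ℝ≥0 × Ω) => X (ceilGrid n p.1) p.2)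
    (fun n => ?_) (tendsto_pi_nhds.2 hlim)
  -- On the grid the time index is countable, so measurability of each `X t` is enough.
  have h : Measurable fun q : ℕ × Ω => X ((q.1 : ℝ≥0) / (n + 1)) q.2 :=
    measurable_from_prod_countable_right fun k => hX ((k : ℝ≥0) / (n + 1))
  have hm : Measurable fun p : ℝ≥0 × Ω => (⌈(n + 1 : ℝ≥0) * p.1⌉₊, p.2) :=
    (Nat.measurable_ceil.comp (measurable_fst.const_mul _)).prodMk measurable_snd
  exact h.comp hm

/-! ### Factorial moments of the Poisson law. -/

theorem integrable_natCast_mul_sub_one_poissonMeasure (r : ℝ≥0) :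
    Integrable (fun n : ℕ => (n : ℝ) * (n - 1)) (poissonMeasure r) ∧
      ∫ n, (n : ℝ) * (n - 1) ∂(poissonMeasure r) = (r : ℝ) ^ 2 := by
  have h : HasSum (fun n : ℕ => Real.exp (-r) * r ^ n / (n.factorial : ℝ) * ((n : ℝ) * (n - 1)))
      ((r : ℝ) ^ 2) := by
    -- The first two terms vanish; shifting the index by two leaves `r ^ 2` times the total mass.
    rw [← hasSum_nat_add_iff' 2]
    simp only [Finset.sum_range_succ, Finset.sum_range_zero]
    convert! (hasSum_one_poissonMeasure r).mul_left ((r : ℝ) ^ 2) using 1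
    · ext n
      rw [show n + 2 = (n + 1) + 1 by rfl, Nat.factorial_succ, Nat.factorial_succ]
      push_cast
      field_simp
      ring
    · simp
  refine ⟨integrable_poissonMeasure_iff.2 ?_, ?_⟩
  · refine h.summable.congr fun n => ?_
    rw [Real.norm_of_nonneg]
    rcases n with _ | n
    · simp
    · push_cast; simp; positivity
  · rw [integral_poissonMeasure]
    simpa using h.tsum_eq

theorem integrable_natCast_poissonMeasure (r : ℝ≥0) :
    Integrable (fun n : ℕ => (n : ℝ)) (poissonMeasure r) ∧
      ∫ n, (n : ℝ) ∂(poissonMeasure r) = (r : ℝ) := by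
  have h : HasSum (fun n : ℕ => Real.exp (-r) * r ^ n / (n.factorial : ℝ) * (n : ℝ)) (r : ℝ) := by
    rw [← hasSum_nat_add_iff' 1]
    simp only [Finset.sum_range_succ, Finset.sum_range_zero]
    convert! (hasSum_one_poissonMeasure r).mul_left (r : ℝ) using 1
    · ext n
      rw [Nat.factorial_succ]
      push_cast
      field_simp
      ring
    · simp
  refine ⟨integrable_poissonMeasure_iff.2 ?_, ?_⟩
  · exact h.summable.congr fun n => by simp
  · rw [integral_poissonMeasure]
    simpa using h.tsum_eq

/-- Markov's inequality for `n(n-1)`, which is at least one when `n ≥ 2`. The quadratic order in `r`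
is what later excludes double jumps. -/
theorem poissonMeasure_Ici_two_le (r : ℝ≥0) :
    poissonMeasure r (Set.Ici 2) ≤ ENNReal.ofReal ((r : ℝ) ^ 2) := by
  obtain ⟨hi, hr⟩ := integrable_natCast_mul_sub_one_poissonMeasure r
  have hnn : ∀ n : ℕ, (0 : ℝ) ≤ n * (n - 1) := by
    rintro (_ | n)
    · simp
    · push_cast; simp; positivity
  rw [← hr, ofReal_integral_eq_lintegral_ofReal hi (.of_forall hnn),
    ← lintegral_indicator_one .of_discrete]
  refine lintegral_mono fun n => ?_
  by_cases h : 2 ≤ n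
  · simp only [Set.mem_Ici, h, Set.indicator_of_mem, Pi.one_apply]
    rw [ENNReal.one_le_ofReal]
    have : (2 : ℝ) ≤ n := mod_cast h
    nlinarith
  · simp [h]

/-! ### Independence of an increment from the past. -/

namespace IsPoissonProcess

variable {Ω : Type*} [MeasurableSpace Ω] {N : ℝ≥0 → Ω → ℕ} {lam : ℝ≥0} {P : Measure Ω}

theorem measurable_increment (hN : IsPoissonProcess N lam P) (s t : ℝ≥0) :
    Measurable fun ω => N t ω - N s ω :=
  (hN.measurable t).sub (hN.measurable s)

/-- Past values are sums of successive increments along a finite chain from `0` to `s`, and these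
are jointly independent of the increment from `s` to `t`. -/
theorem indepFun_tuple_increment (hN : IsPoissonProcess N lam P) {s t : ℝ≥0} (hst : s ≤ t)
    (I : Finset (Set.Iic s)) :
    IndepFun (fun ω (i : I) => N i ω) (fun ω => N t ω - N s ω) P := by
  classical
  -- Adjoining `0` lets every value telescope from `N 0 = 0`; adjoining `s` makes the last step of
  -- the chain exactly `s` to `t`.
  set J : Finset ℝ≥0 := insert 0 (insert s (I.image Subtype.val)) with hJ
  have hJs : ∀ x ∈ J, x ≤ s := by
    intro x hx
    simp only [hJ, Finset.mem_insert, Finset.mem_image] at hx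
    rcases hx with rfl | rfl | ⟨y, -, rfl⟩
    exacts [zero_le, le_rfl, y.2]
  obtain ⟨c, hc⟩ : ∃ c, J.card = c + 1 :=
    Nat.exists_eq_succ_of_ne_zero (Finset.card_ne_zero.2 ⟨0, Finset.mem_insert_self _ _⟩)
  set e := J.orderEmbOfFin hc with he
  have hsurj : ∀ x ∈ J, ∃ i, e i = x := fun x hx => by
    have : x ∈ Set.range e := by rw [he, Finset.range_orderEmbOfFin]; exact hx
    exact this
  have heJ : ∀ i, e i ∈ J := fun i => Finset.orderEmbOfFin_mem J hc i
  -- The sorted points of `J`, then constantly `t`: increments `0, …, c-1` are the past and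
  -- increment `c` is the one of interest.
  set g : ℕ → ℝ≥0 := fun i => if h : i < c + 1 then e ⟨i, h⟩ else t with hg
  have hge : ∀ i : Fin (c + 1), g i = e i := fun i => dif_pos i.2
  have hmono : Monotone g := by
    intro i j hij
    by_cases hj : j < c + 1
    · have hi : i < c + 1 := hij.trans_lt hj
      simp only [hg, hi, hj, dif_pos]
      exact e.monotone (by simpa using hij)
    · by_cases hi : i < c + 1
      · simp only [hg, hi, hj, dif_pos, dif_neg, not_false_eq_true]
        exact (hJs _ (heJ _)).trans hst
      · simp only [hg, hi, hj, dif_neg, not_false_eq_true, le_refl]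
  have h0 : g 0 = 0 := by
    obtain ⟨i, hi⟩ := hsurj 0 (Finset.mem_insert_self _ _)
    exact le_antisymm ((hmono (Nat.zero_le i)).trans_eq ((hge i).trans hi)) zero_le
  have hgc : g c = s := by
    obtain ⟨i, hi⟩ := hsurj s (by simp [hJ])
    refine le_antisymm ?_ ?_
    · have := hge (Fin.last c)
      rw [Fin.val_last] at this
      exact this ▸ hJs _ (heJ _)
    · exact (hi.symm.trans (hge i).symm).trans_le (hmono (Nat.lt_succ_iff.1 i.2))
  have hgc1 : g (c + 1) = t := by simp [hg]
  have hind := (hN.indepIncrements.nat hmono).indepFun_finset (Finset.range c) {c}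
    (by simp) (fun i => hN.measurable_increment _ _)
  have hk : ∀ i : I, ∃ k : Fin (c + 1), e k = (i : Set.Iic s) := fun i => by
    refine hsurj _ ?_
    simp only [hJ, Finset.mem_insert, Finset.mem_image]
    exact .inr (.inr ⟨i, i.2, rfl⟩)
  choose k hk using hk
  have hsum : ∀ i : I, ∀ ω, N i ω =
      ∑ j : Finset.range c, if (j : ℕ) < k i then N (g (j + 1)) ω - N (g j) ω else 0 := by
    intro i ω
    have h1 : N (g (k i)) ω = ∑ j ∈ Finset.range (k i), (N (g (j + 1)) ω - N (g j) ω) := by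
      rw [Finset.sum_range_tsub (f := fun j => N (g j) ω) ((hN.mono ω).comp hmono), h0, hN.zero,
        tsub_zero]
    rw [← hk i, ← hge, h1, Finset.sum_coe_sort (Finset.range c)
      (fun j => if j < (k i : ℕ) then N (g (j + 1)) ω - N (g j) ω else 0), ← Finset.sum_filter]
    refine Finset.sum_congr ?_ fun _ _ => rfl
    ext j
    have := (k i).2
    simp only [Finset.mem_range, Finset.mem_filter]
    omega
  have hcomp := hind.comp
    (φ := fun (v : Finset.range c → ℕ) (i : I) =>
      ∑ j : Finset.range c, if (j : ℕ) < k i then v j else 0)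
    (ψ := fun (v : ({c} : Finset ℕ) → ℕ) => v ⟨c, by simp⟩)
    .of_discrete .of_discrete
  convert! hcomp using 1
  · ext ω i
    simp [hsum i ω]
  · ext ω
    simp [hgc, hgc1]

theorem indep_filtration_increment [IsProbabilityMeasure P] (hN : IsPoissonProcess N lam P)
    {s t : ℝ≥0} (hst : s ≤ t) :
    Indep (hN.filtration s) (MeasurableSpace.comap (fun ω => N t ω - N s ω) ⊤) P := by
  rw [IsPoissonProcess.filtration, Filtration.natural_eq_comap]
  exact (IndepFun_iff_Indep _ _ _).1 (IndepFun.process_indepFun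
    (X := fun (j : Set.Iic s) ω => N j ω) (fun j => hN.measurable j)
    (hN.measurable_increment s t) (hN.indepFun_tuple_increment hst))

theorem measurable_filtration (hN : IsPoissonProcess N lam P) {s t : ℝ≥0} (hst : s ≤ t) :
    Measurable[hN.filtration t] (N s) :=
  ((Filtration.stronglyAdapted_natural fun t => (hN.measurable t).stronglyMeasurable) s).measurable.mono
    (hN.filtration.mono hst) le_rfl

end IsPoissonProcess

/-! ### Drift computations and the two martingales. -/

/-- Trades conditional expectations for integrals over past events, where independence and Fubini
apply directly. -/
theorem martingale_of_setIntegral_eq {Ω ι : Type*} [Preorder ι] {mΩ : MeasurableSpace Ω}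
    {P : Measure Ω} [IsFiniteMeasure P] {ℱ : Filtration ι mΩ} {X : ι → Ω → ℝ}
    (hadp : StronglyAdapted ℱ X) (hint : ∀ t, Integrable (X t) P)
    (h : ∀ s t, s ≤ t → ∀ A, MeasurableSet[ℱ s] A → ∫ ω in A, X t ω ∂P = ∫ ω in A, X s ω ∂P) :
    Martingale X ℱ P :=
  ⟨hadp, fun s t hst => (ae_eq_condExp_of_forall_setIntegral_eq (ℱ.le s) (hint t)
    (fun _ _ _ => (hint s).integrableOn) (fun A hA _ => (h s t hst A hA).symm)
    (hadp s).aestronglyMeasurable).symm⟩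

/-- Freezing the process at `t` makes the integrand measurable with respect to the past of `t` at
every `u`, as adaptedness of `W` requires. -/
theorem cumulativeWaiting_eq_min {Ω : Type*} {N : ℝ≥0 → Ω → ℕ} (t : ℝ≥0) (ω : Ω) :
    cumulativeWaiting N t ω = ∫ u in Set.Ioc (0 : ℝ) t, (N (min u.toNNReal t) ω : ℝ) := by
  rw [cumulativeWaiting, intervalIntegral.integral_of_le t.coe_nonneg]
  refine setIntegral_congr_fun measurableSet_Ioc fun u hu => ?_
  rw [min_eq_left (Real.toNNReal_le_iff_le_coe.2 hu.2)]

theorem cumulativeWaiting_zero {Ω : Type*} {N : ℝ≥0 → Ω → ℕ} (ω : Ω) : cumulativeWaiting N 0 ω = 0 := by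
  simp [cumulativeWaiting]

theorem cumulativeWaiting_nonneg {Ω : Type*} {N : ℝ≥0 → Ω → ℕ} (t : ℝ≥0) (ω : Ω) :
    0 ≤ cumulativeWaiting N t ω :=
  intervalIntegral.integral_nonneg t.2 fun _ _ => by positivity

namespace IsPoissonProcess

variable {Ω : Type*} [mΩ : MeasurableSpace Ω] {N : ℝ≥0 → Ω → ℕ} {lam : ℝ≥0} {P : Measure Ω}

theorem hasLaw (hN : IsPoissonProcess N lam P) (t : ℝ≥0) :
    HasLaw (N t) (poissonMeasure (lam * t)) P := by
  simpa [hN.zero] using hN.law_increment 0 t zero_le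

theorem integrable_comp_of_hasLaw {Y : Ω → ℕ} {μ : Measure ℕ} (hY : HasLaw Y μ P) {f : ℕ → ℝ}
    (hf : Integrable f μ) : Integrable (fun ω => f (Y ω)) P := by
  rw [← hY.map_eq] at hf
  exact hf.comp_aemeasurable hY.aemeasurable

theorem integrable_natCast (hN : IsPoissonProcess N lam P) (t : ℝ≥0) :
    Integrable (fun ω => (N t ω : ℝ)) P :=
  integrable_comp_of_hasLaw (hN.hasLaw t) (integrable_natCast_poissonMeasure _).1

theorem integrable_mul_sub_one (hN : IsPoissonProcess N lam P) (t : ℝ≥0) :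
    Integrable (fun ω => (N t ω : ℝ) * (N t ω - 1)) P :=
  integrable_comp_of_hasLaw (f := fun n => (n : ℝ) * (n - 1)) (hN.hasLaw t)
    (integrable_natCast_mul_sub_one_poissonMeasure _).1

theorem integrable_sq (hN : IsPoissonProcess N lam P) (t : ℝ≥0) :
    Integrable (fun ω => (N t ω : ℝ) ^ 2) P := by
  refine ((hN.integrable_mul_sub_one t).add (hN.integrable_natCast t)).congr (.of_forall fun ω => ?_)
  simp only [Pi.add_apply]
  ring

/-- The function `f` cut off to `A` depends only on the past of `s`, hence is independent of the
increment. -/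
theorem setIntegral_mul_increment [IsProbabilityMeasure P] (hN : IsPoissonProcess N lam P)
    {s t : ℝ≥0} (hst : s ≤ t) {A : Set Ω} (hA : MeasurableSet[hN.filtration s] A) {f : Ω → ℝ}
    (hf : Measurable[hN.filtration s] f) (g : ℕ → ℝ) :
    ∫ ω in A, f ω * g (N t ω - N s ω) ∂P
      = (∫ ω in A, f ω ∂P) * ∫ n, g n ∂(poissonMeasure (lam * (t - s))) := by
  have hA' := hN.filtration.le s _ hA
  have hfA : Measurable[hN.filtration s] (A.indicator f) := hf.indicator hA
  have hind : IndepFun (A.indicator f) (fun ω => N t ω - N s ω) P := by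
    rw [IndepFun_iff_Indep]
    exact indep_of_indep_of_le_left (hN.indep_filtration_increment hst) hfA.comap_le
  have h := (hind.comp (φ := id) (ψ := g) measurable_id .of_discrete).integral_mul_eq_mul_integral
    (hfA.mono (hN.filtration.le s) le_rfl).aestronglyMeasurable
    ((Measurable.of_discrete (f := g)).comp (hN.measurable_increment s t)).aestronglyMeasurable
  rw [← integral_indicator hA', ← integral_indicator hA',
    ← (hN.law_increment s t hst).integral_comp .of_discrete]
  refine Eq.trans (integral_congr_ae (.of_forall fun ω => ?_)) h
  by_cases hω : ω ∈ A <;> simp [hω]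

theorem setIntegral_natCast [IsProbabilityMeasure P] (hN : IsPoissonProcess N lam P)
    {s t : ℝ≥0} (hst : s ≤ t) {A : Set Ω} (hA : MeasurableSet[hN.filtration s] A) :
    ∫ ω in A, (N t ω : ℝ) ∂P = ∫ ω in A, (N s ω : ℝ) ∂P + lam * (t - s) * P.real A := by
  have h := hN.setIntegral_mul_increment hst hA (f := fun _ => 1) measurable_const (fun n => (n : ℝ))
  rw [(integrable_natCast_poissonMeasure _).2] at h
  have h2 : ∀ ω, (1 : ℝ) * ((N t ω - N s ω : ℕ) : ℝ) = N t ω - N s ω := fun ω => by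
    rw [Nat.cast_sub (hN.mono ω hst), one_mul]
  simp only [h2] at h
  rw [integral_sub (hN.integrable_natCast t).integrableOn (hN.integrable_natCast s).integrableOn] at h
  simp only [integral_const, smul_eq_mul, NNReal.coe_mul, NNReal.coe_sub hst, mul_one,
    measureReal_restrict_apply_univ] at h
  linarith

theorem setIntegral_mul_sub_one [IsProbabilityMeasure P] (hN : IsPoissonProcess N lam P)
    {s t : ℝ≥0} (hst : s ≤ t) {A : Set Ω} (hA : MeasurableSet[hN.filtration s] A) :
    ∫ ω in A, (N t ω : ℝ) * (N t ω - 1) ∂P = ∫ ω in A, (N s ω : ℝ) * (N s ω - 1) ∂P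
      + 2 * (lam * (t - s)) * ∫ ω in A, (N s ω : ℝ) ∂P + (lam * (t - s)) ^ 2 * P.real A := by
  have hs : Measurable[hN.filtration s] fun ω => (N s ω : ℝ) :=
    Measurable.comp .of_discrete (hN.measurable_filtration le_rfl)
  have h1 := hN.setIntegral_mul_increment hst hA (f := fun _ => 1) measurable_const
    (fun n => (n : ℝ) * (n - 1))
  have h2 := hN.setIntegral_mul_increment hst hA hs (fun n => (n : ℝ))
  rw [(integrable_natCast_mul_sub_one_poissonMeasure _).2] at h1
  rw [(integrable_natCast_poissonMeasure _).2] at h2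
  have e : ∀ ω, ((N t ω - N s ω : ℕ) : ℝ) = N t ω - N s ω := fun ω =>
    Nat.cast_sub (hN.mono ω hst)
  simp only [e, one_mul] at h1 h2
  simp only [integral_const, smul_eq_mul, NNReal.coe_mul, NNReal.coe_sub hst, mul_one,
    measureReal_restrict_apply_univ] at h1 h2
  -- Dominated by `N t ^ 2`, because `0 ≤ N s ≤ N t`.
  have hst' : Integrable (fun ω => (N s ω : ℝ) * (N t ω - N s ω)) P := by
    refine (hN.integrable_sq t).mono' ?_ (.of_forall fun ω => ?_)
    · have := hN.measurable s; have := hN.measurable t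
      fun_prop
    · have h : (N s ω : ℝ) ≤ N t ω := mod_cast hN.mono ω hst
      have h0 : (0 : ℝ) ≤ N s ω := by positivity
      rw [Real.norm_of_nonneg (mul_nonneg h0 (by linarith))]
      nlinarith
  have e2 : ∀ ω, ((N t ω : ℝ) - N s ω) * (N t ω - N s ω - 1)
      = (N t ω * (N t ω - 1) - N s ω * (N s ω - 1)) - 2 * (N s ω * (N t ω - N s ω)) := fun ω => by
    ring
  simp only [e2] at h1
  rw [integral_sub (f := fun ω => (N t ω : ℝ) * (N t ω - 1) - N s ω * (N s ω - 1))
    ((hN.integrable_mul_sub_one t).sub (hN.integrable_mul_sub_one s)).integrableOn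
    (hst'.const_mul 2).integrableOn, integral_sub (hN.integrable_mul_sub_one t).integrableOn
    (hN.integrable_mul_sub_one s).integrableOn, integral_const_mul, h2] at h1
  linarith

theorem intervalIntegrable (hN : IsPoissonProcess N lam P) (ω : Ω) (a b : ℝ) :
    IntervalIntegrable (fun u : ℝ => (N u.toNNReal ω : ℝ)) volume a b :=
  Monotone.intervalIntegrable fun _ _ huv => Nat.cast_le.2 (hN.mono ω (Real.toNNReal_le_toNNReal huv))

theorem cumulativeWaiting_mono (hN : IsPoissonProcess N lam P) (ω : Ω) :
    Monotone fun t => cumulativeWaiting N t ω := fun s t hst =>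
  intervalIntegral.integral_mono_interval le_rfl s.2 hst (.of_forall fun _ => by positivity)
    (hN.intervalIntegrable ω _ _)

theorem cumulativeWaiting_le (hN : IsPoissonProcess N lam P) (t : ℝ≥0) (ω : Ω) :
    cumulativeWaiting N t ω ≤ t * N t ω := by
  refine (intervalIntegral.integral_mono_on t.2 (hN.intervalIntegrable ω _ _)
    intervalIntegrable_const (g := fun _ => (N t ω : ℝ)) fun u hu => ?_).trans_eq (by simp)
  exact Nat.cast_le.2 (hN.mono ω (Real.toNNReal_le_iff_le_coe.2 hu.2))

theorem continuous_cumulativeWaiting (hN : IsPoissonProcess N lam P) (ω : Ω) :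
    Continuous fun t : ℝ≥0 => cumulativeWaiting N t ω :=
  (intervalIntegral.continuous_primitive (fun a b => hN.intervalIntegrable ω a b) 0).comp
    NNReal.continuous_coe

/-- Progressive measurability: the process frozen at `t` is still right-continuous, and all its
values lie in the past of `t`. -/
theorem measurable_stopped_uncurry (hN : IsPoissonProcess N lam P) (t : ℝ≥0) :
    Measurable[Prod.instMeasurableSpace (m₂ := hN.filtration t)]
      (fun p : ℝ≥0 × Ω => N (min p.1 t) p.2) := by
  refine @measurable_uncurry_of_rightCts Ω ℕ (hN.filtration t) _ _ _ _ (fun u ω => N (min u t) ω)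
    (fun u => hN.measurable_filtration (min_le_right _ _)) fun ω u => ?_
  refine ContinuousWithinAt.comp (g := fun v => N v ω) (t := Set.Ici (min u t))
    (hN.rightCts ω (min u t)) (by fun_prop) fun v hv => ?_
  exact min_le_min_right t hv

theorem measurable_stopped_uncurry_real (hN : IsPoissonProcess N lam P) (t : ℝ≥0) :
    Measurable[Prod.instMeasurableSpace (m₂ := hN.filtration t)]
      (fun p : ℝ × Ω => (N (min p.1.toNNReal t) p.2 : ℝ)) := by
  have h := hN.measurable_stopped_uncurry t
  exact (Measurable.of_discrete (f := fun n : ℕ => (n : ℝ))).comp (h.comp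
    ((measurable_real_toNNReal.comp measurable_fst).prodMk measurable_snd))

theorem stronglyMeasurable_cumulativeWaiting (hN : IsPoissonProcess N lam P) (t : ℝ≥0) :
    StronglyMeasurable[hN.filtration t] (cumulativeWaiting N t) := by
  have h := (hN.measurable_stopped_uncurry_real t).stronglyMeasurable
  have h2 := @StronglyMeasurable.integral_prod_left' ℝ Ω ℝ _ (hN.filtration t)
    (volume.restrict (Set.Ioc (0 : ℝ) t)) _ _ _ _ h
  convert! h2 using 1
  ext ω
  exact cumulativeWaiting_eq_min t ω

theorem integrable_cumulativeWaiting (hN : IsPoissonProcess N lam P) (t : ℝ≥0) :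
    Integrable (cumulativeWaiting N t) P := by
  refine ((hN.integrable_natCast t).const_mul (t : ℝ)).mono'
    ((hN.stronglyMeasurable_cumulativeWaiting t).mono (hN.filtration.le t)).aestronglyMeasurable
    (.of_forall fun ω => ?_)
  rw [Real.norm_of_nonneg (cumulativeWaiting_nonneg t ω)]
  exact hN.cumulativeWaiting_le t ω

theorem setIntegral_cumulativeWaiting_sub [IsProbabilityMeasure P] (hN : IsPoissonProcess N lam P)
    {s t : ℝ≥0} (hst : s ≤ t) {A : Set Ω} (hA : MeasurableSet[hN.filtration s] A) :
    ∫ ω in A, (cumulativeWaiting N t ω - cumulativeWaiting N s ω) ∂P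
      = (t - s) * ∫ ω in A, (N s ω : ℝ) ∂P + lam * (t - s) ^ 2 / 2 * P.real A := by
  have hW : ∀ ω, cumulativeWaiting N t ω - cumulativeWaiting N s ω
      = ∫ u in Set.Ioc (s : ℝ) t, (N (min u.toNNReal t) ω : ℝ) := by
    intro ω
    rw [cumulativeWaiting, cumulativeWaiting, intervalIntegral.integral_interval_sub_left
      (hN.intervalIntegrable ω _ _) (hN.intervalIntegrable ω _ _),
      intervalIntegral.integral_of_le (NNReal.coe_le_coe.2 hst)]
    refine setIntegral_congr_fun measurableSet_Ioc fun u hu => ?_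
    rw [min_eq_left (Real.toNNReal_le_iff_le_coe.2 hu.2)]
  simp only [hW]
  have hm : Measurable fun p : ℝ × Ω => (N (min p.1.toNNReal t) p.2 : ℝ) :=
    (hN.measurable_stopped_uncurry_real t).mono
      (sup_le_sup_left (MeasurableSpace.comap_mono (hN.filtration.le t)) _) le_rfl
  -- After Fubini the inner integral is affine in `u`, with slope `λ P(A)`; domination by `N t` on a
  -- bounded interval justifies the swap.
  rw [integral_integral_swap]
  · have hu : ∀ u ∈ Set.Ioc (s : ℝ) t, ∫ ω in A, (N (min u.toNNReal t) ω : ℝ) ∂P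
        = ∫ ω in A, (N s ω : ℝ) ∂P + lam * (u - s) * P.real A := by
      intro u hu
      have h0 : (0 : ℝ) ≤ u := s.2.trans hu.1.le
      rw [min_eq_left (Real.toNNReal_le_iff_le_coe.2 hu.2),
        hN.setIntegral_natCast (NNReal.le_toNNReal_of_coe_le hu.1.le) hA, Real.coe_toNNReal _ h0]
    rw [setIntegral_congr_fun measurableSet_Ioc hu,
      ← intervalIntegral.integral_of_le (NNReal.coe_le_coe.2 hst),
      intervalIntegral.integral_add intervalIntegrable_const
        (Continuous.intervalIntegrable (by fun_prop) _ _),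
      intervalIntegral.integral_mul_const, intervalIntegral.integral_const_mul,
      intervalIntegral.integral_sub intervalIntegral.intervalIntegrable_id intervalIntegrable_const]
    simp only [intervalIntegral.integral_const, integral_id, smul_eq_mul]
    ring
  · refine Integrable.mono' (g := fun p : Ω × ℝ => (N t p.1 : ℝ))
      ((hN.integrable_natCast t).integrableOn.comp_fst _)
      (hm.comp measurable_swap).aestronglyMeasurable (.of_forall fun p => ?_)
    simp only [Function.uncurry, Real.norm_natCast, Nat.cast_le]
    exact hN.mono _ (min_le_right _ _)

theorem martingale_compensated [IsProbabilityMeasure P] (hN : IsPoissonProcess N lam P) :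
    Martingale (fun (t : ℝ≥0) (ω : Ω) => (N t ω : ℝ) - lam * t) hN.filtration P := by
  refine martingale_of_setIntegral_eq (fun t => ?_)
    (fun t => (hN.integrable_natCast t).sub (integrable_const _)) fun s t hst A hA => ?_
  · exact (Measurable.stronglyMeasurable
      (Measurable.comp .of_discrete (hN.measurable_filtration le_rfl))).sub stronglyMeasurable_const
  · rw [integral_sub (hN.integrable_natCast t).integrableOn integrableOn_const,
      integral_sub (hN.integrable_natCast s).integrableOn integrableOn_const,
      hN.setIntegral_natCast hst hA]
    simp only [integral_const, smul_eq_mul, measureReal_restrict_apply_univ]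
    ring

theorem martingale_cumulativeWaiting [IsProbabilityMeasure P] (hN : IsPoissonProcess N lam P)
    (hlam : 0 < lam) :
    Martingale (fun (t : ℝ≥0) (ω : Ω) => cumulativeWaiting N t ω
        - (N t ω : ℝ) ^ 2 / (2 * (lam : ℝ)) + (N t ω : ℝ) / (2 * (lam : ℝ))) hN.filtration P := by
  have e : ∀ (t : ℝ≥0) (ω : Ω), cumulativeWaiting N t ω
        - (N t ω : ℝ) ^ 2 / (2 * (lam : ℝ)) + (N t ω : ℝ) / (2 * (lam : ℝ))
      = cumulativeWaiting N t ω - (2 * (lam : ℝ))⁻¹ * ((N t ω : ℝ) * (N t ω - 1)) := fun t ω => by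
    ring
  simp only [e]
  have hl : (lam : ℝ) ≠ 0 := NNReal.coe_ne_zero.2 hlam.ne'
  refine martingale_of_setIntegral_eq (fun t => ?_)
    (fun t => (hN.integrable_cumulativeWaiting t).sub ((hN.integrable_mul_sub_one t).const_mul _))
    fun s t hst A hA => ?_
  · exact (hN.stronglyMeasurable_cumulativeWaiting t).sub (Measurable.stronglyMeasurable
      (Measurable.comp (g := fun n : ℕ => (2 * (lam : ℝ))⁻¹ * ((n : ℝ) * (n - 1))) .of_discrete
        (hN.measurable_filtration le_rfl)))
  · have hW := hN.setIntegral_cumulativeWaiting_sub hst hA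
    rw [integral_sub (hN.integrable_cumulativeWaiting t).integrableOn
      (hN.integrable_cumulativeWaiting s).integrableOn] at hW
    rw [integral_sub (hN.integrable_cumulativeWaiting t).integrableOn
        ((hN.integrable_mul_sub_one t).const_mul _).integrableOn,
      integral_sub (hN.integrable_cumulativeWaiting s).integrableOn
        ((hN.integrable_mul_sub_one s).const_mul _).integrableOn,
      integral_const_mul, integral_const_mul, hN.setIntegral_mul_sub_one hst hA,
      eq_add_of_sub_eq hW]
    field_simp
    ring

end IsPoissonProcess

/-! ### Optional stopping in continuous time. -/

/-- `stoppedValue` evaluates through `untopA`, an arbitrary value at `∞`, so the two conversions are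
compared at finite times only. -/
theorem untopA_eq_toNNReal {a : ℝ≥0∞} (h : a ≠ ∞) : WithTop.untopA a = a.toNNReal := by
  lift a to ℝ≥0 using h
  rfl

theorem stoppedValue_eq_toNNReal {Ω β : Type*} {X : ℝ≥0 → Ω → β} {τ : Ω → ℝ≥0∞} {ω : Ω}
    (h : τ ω ≠ ∞) : stoppedValue (ι := ℝ≥0) X τ ω = X (τ ω).toNNReal ω :=
  congrArg (fun u => X u ω) (untopA_eq_toNNReal h)

section StoppingTime

variable {Ω : Type*} [mΩ : MeasurableSpace Ω] {ℱ : Filtration ℝ≥0 mΩ} {P : Measure Ω}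

theorem MeasureTheory.IsStoppingTime.map_ceilGrid {τ : Ω → WithTop ℝ≥0} (hτ : IsStoppingTime ℱ τ)
    (n : ℕ) : IsStoppingTime ℱ fun ω => (τ ω).map (ceilGrid n) := by
  intro t
  have h : (⌊(n + 1 : ℝ≥0) * t⌋₊ : ℝ≥0) / (n + 1) ≤ t := by
    rw [div_le_iff₀ (by positivity), mul_comm t]
    exact Nat.floor_le (by positivity)
  convert! ℱ.mono h _ (hτ _) using 1
  ext ω
  change (τ ω).map (ceilGrid n) ≤ (t : WithTop ℝ≥0)
    ↔ τ ω ≤ (((⌊(n + 1 : ℝ≥0) * t⌋₊ : ℝ≥0) / (n + 1) : ℝ≥0) : WithTop ℝ≥0)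
  rcases τ ω with _ | u
  · exact iff_of_false (WithTop.not_top_le_coe _) (WithTop.not_top_le_coe _)
  · exact WithTop.coe_le_coe.trans ((ceilGrid_le_iff n u t).trans WithTop.coe_le_coe.symm)

theorem MeasureTheory.IsStoppingTime.measurable_ennreal {τ : Ω → ℝ≥0∞}
    (hτ : IsStoppingTime ℱ τ) : Measurable τ := by
  refine measurable_of_Iic fun a => ?_
  induction a with
  | top => simp
  | coe a => exact ℱ.le a _ (hτ a)

theorem MeasureTheory.IsStoppingTime.min_coe {τ : Ω → ℝ≥0∞} (hτ : IsStoppingTime ℱ τ) (t : ℝ≥0) :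
    IsStoppingTime ℱ (fun ω => min (τ ω) (t : ℝ≥0∞)) :=
  hτ.min_const t

/-- Optional stopping at a bounded stopping time, for a right-continuous martingale that is
dominated by an integrable function. -/
theorem MeasureTheory.Martingale.integral_stoppedValue_of_rightCts [IsFiniteMeasure P]
    {X : ℝ≥0 → Ω → ℝ} (hX : Martingale X ℱ P)
    (hc : ∀ ω t, ContinuousWithinAt (fun u => X u ω) (Set.Ici t) t)
    {τ : Ω → WithTop ℝ≥0} (hτ : IsStoppingTime ℱ τ) {T : ℝ≥0} (hT : ∀ ω, τ ω ≤ T) {g : Ω → ℝ}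
    (hg : Integrable g P) (hdom : ∀ t ≤ T + 1, ∀ ω, ‖X t ω‖ ≤ g ω) :
    ∫ ω, stoppedValue X τ ω ∂P = ∫ ω, X 0 ω ∂P := by
  have htop : ∀ ω, τ ω ≠ ⊤ := fun ω => ((hT ω).trans_lt (WithTop.coe_lt_top T)).ne
  have hval : ∀ n ω, stoppedValue X (fun ω => (τ ω).map (ceilGrid n)) ω
      = X (ceilGrid n (τ ω).untopA) ω := by
    intro n ω
    obtain ⟨u, hu⟩ := WithTop.ne_top_iff_exists.1 (htop ω)
    rw [stoppedValue, ← hu]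
    rfl
  have hle : ∀ ω, (τ ω).untopA ≤ T := fun ω => (WithTop.untopA_le_iff (htop ω)).2 (hT ω)
  -- The rounded time has countable range and is at most `T + 1`, so optional stopping for countably
  -- many values applies.
  have hint : ∀ n, ∫ ω, stoppedValue X (fun ω => (τ ω).map (ceilGrid n)) ω ∂P
      = ∫ ω, X 0 ω ∂P := by
    intro n
    have hτn := hτ.map_ceilGrid n
    have hbd : ∀ ω, (τ ω).map (ceilGrid n) ≤ ((T + 1 : ℝ≥0) : WithTop ℝ≥0) := by
      intro ω
      obtain ⟨u, hu⟩ := WithTop.ne_top_iff_exists.1 (htop ω)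
      have h := hT ω
      rw [← hu] at h ⊢
      rw [WithTop.map_coe]
      exact WithTop.coe_le_coe.2 ((ceilGrid_le_add_one n u).trans
        (add_le_add_left (WithTop.coe_le_coe.1 h) 1))
    have hcount : (Set.range fun ω => (τ ω).map (ceilGrid n)).Countable := by
      refine ((Set.countable_range fun j : ℕ =>
        (((j : ℝ≥0) / (n + 1) : ℝ≥0) : WithTop ℝ≥0)).mono ?_)
      rintro _ ⟨ω, rfl⟩
      obtain ⟨u, hu⟩ := WithTop.ne_top_iff_exists.1 (htop ω)
      exact ⟨⌈(n + 1 : ℝ≥0) * u⌉₊, (congrArg (WithTop.map (ceilGrid n)) hu : _)⟩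
    rw [integral_congr_ae
      (hX.stoppedValue_ae_eq_condExp_of_le_const_of_countable_range hτn hbd hcount),
      integral_condExp hτn.measurableSpace_le]
    simpa using (hX.setIntegral_eq (zero_le (a := T + 1)) MeasurableSet.univ).symm
  have hmeas : ∀ n, AEStronglyMeasurable
      (stoppedValue X (fun ω => (τ ω).map (ceilGrid n))) P := by
    intro n
    have h1 : Measurable fun p : ℝ≥0 × Ω => X p.1 p.2 := measurable_uncurry_of_rightCts
      (fun t => ((hX.1 t).mono (ℱ.le t)).measurable) hc
    have h2 : Measurable fun ω => (τ ω).untopA := by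
      have : Measurable fun ω => (show Ω → ℝ≥0∞ from τ) ω := IsStoppingTime.measurable_ennreal hτ
      convert! this.ennreal_toNNReal using 2 with ω
      exact untopA_eq_toNNReal (htop ω)
    refine Measurable.aestronglyMeasurable ?_
    rw [funext (hval n)]
    exact h1.comp (((measurable_ceilGrid n).comp h2).prodMk measurable_id)
  have hlim : Tendsto (fun n => ∫ ω, stoppedValue X (fun ω => (τ ω).map (ceilGrid n)) ω ∂P) atTop
      (𝓝 (∫ ω, stoppedValue X τ ω ∂P)) := ?_
  · exact tendsto_nhds_unique hlim (tendsto_const_nhds.congr fun n => (hint n).symm)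
  -- The rounded times approach `τ` from the right, so right-continuity gives pointwise convergence.
  refine tendsto_integral_of_dominated_convergence g hmeas hg (fun n => .of_forall fun ω => ?_)
    (.of_forall fun ω => ?_)
  · rw [hval]
    exact hdom _ ((ceilGrid_le_add_one n _).trans (add_le_add_left (hle ω) 1)) ω
  · simp only [hval]
    exact Tendsto.comp (g := fun u => X u ω) (hc ω _) (tendsto_ceilGrid _)

theorem MeasureTheory.Martingale.integral_min_of_rightCts [IsFiniteMeasure P]
    {X : ℝ≥0 → Ω → ℝ} (hX : Martingale X ℱ P)
    (hc : ∀ ω t, ContinuousWithinAt (fun u => X u ω) (Set.Ici t) t)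
    {τ : Ω → ℝ≥0∞} (hτ : IsStoppingTime ℱ τ) (T : ℝ≥0) {g : Ω → ℝ}
    (hg : Integrable g P) (hdom : ∀ t ≤ T + 1, ∀ ω, ‖X t ω‖ ≤ g ω) :
    ∫ ω, X (min (τ ω) T).toNNReal ω ∂P = ∫ ω, X 0 ω ∂P := by
  refine Eq.trans (integral_congr_ae (.of_forall fun ω => ?_))
    (hX.integral_stoppedValue_of_rightCts hc (hτ.min_coe T) (T := T)
      (fun ω => min_le_right _ _) hg hdom)
  exact (stoppedValue_eq_toNNReal (τ := fun ω => min (τ ω) (T : ℝ≥0∞)) (by simp)).symm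

/-- Monotone convergence along the truncations of a time `τ` that is finite almost surely. -/
theorem tendsto_lintegral_min_natCast {G : ℝ≥0 → Ω → ℝ≥0∞}
    (hG : Measurable fun p : ℝ≥0 × Ω => G p.1 p.2) (hmono : ∀ ω, Monotone fun t => G t ω)
    {τ : Ω → ℝ≥0∞} (hτ : Measurable τ) (hfin : ∀ᵐ ω ∂P, τ ω ≠ ∞) :
    Tendsto (fun n : ℕ => ∫⁻ ω, G (min (τ ω) ((n : ℝ≥0) : ℝ≥0∞)).toNNReal ω ∂P) atTop
      (𝓝 (∫⁻ ω, stoppedValue (ι := ℝ≥0) G τ ω ∂P)) := by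
  refine lintegral_tendsto_of_tendsto_of_monotone (fun n => ?_) (.of_forall fun ω => ?_) ?_
  · exact (hG.comp ((hτ.min measurable_const).ennreal_toNNReal.prodMk measurable_id)).aemeasurable
  · intro m n hmn
    refine hmono ω (ENNReal.toNNReal_mono (by simp) (min_le_min_left _ ?_))
    exact mod_cast hmn
  · filter_upwards [hfin] with ω hω
    obtain ⟨n, hn⟩ := exists_nat_ge (τ ω).toNNReal
    refine tendsto_const_nhds.congr' ?_
    filter_upwards [eventually_ge_atTop n] with m hm
    have : τ ω ≤ ((m : ℝ≥0) : ℝ≥0∞) := by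
      rw [← ENNReal.coe_toNNReal hω, ENNReal.coe_le_coe]
      exact hn.trans (mod_cast hm)
    rw [min_eq_left this, stoppedValue_eq_toNNReal hω]

end StoppingTime

/-! ### Wald-type identities, first at truncated and then at general stopping times. -/

namespace IsPoissonProcess

variable {Ω : Type*} [mΩ : MeasurableSpace Ω] {N : ℝ≥0 → Ω → ℕ} {lam : ℝ≥0} {P : Measure Ω}

theorem measurable_uncurry (hN : IsPoissonProcess N lam P) :
    Measurable fun p : ℝ≥0 × Ω => N p.1 p.2 :=
  measurable_uncurry_of_rightCts hN.measurable hN.rightCts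

theorem measurable_uncurry_cumulativeWaiting (hN : IsPoissonProcess N lam P) :
    Measurable fun p : ℝ≥0 × Ω => cumulativeWaiting N p.1 p.2 :=
  measurable_uncurry_of_rightCts
    (fun t => ((hN.stronglyMeasurable_cumulativeWaiting t).mono (hN.filtration.le t)).measurable)
    fun ω _ => (hN.continuous_cumulativeWaiting ω).continuousWithinAt

theorem rightCts_comp (hN : IsPoissonProcess N lam P) (f : ℕ → ℝ) (ω : Ω) (t : ℝ≥0) :
    ContinuousWithinAt (fun u => f (N u ω)) (Set.Ici t) t :=
  (continuous_of_discreteTopology (f := f)).continuousAt.comp_continuousWithinAt (hN.rightCts ω t)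

variable [IsProbabilityMeasure P]

theorem lintegral_stopped_min (hN : IsPoissonProcess N lam P) {τ : Ω → ℝ≥0∞}
    (hτ : IsStoppingTime hN.filtration τ) (t : ℝ≥0) :
    ∫⁻ ω, (N (min (τ ω) t).toNNReal ω : ℝ≥0∞) ∂P = lam * ∫⁻ ω, min (τ ω) t ∂P := by
  have htop : ∀ ω, min (τ ω) (t : ℝ≥0∞) ≠ ∞ := fun ω => by simp
  have hle : ∀ ω, (min (τ ω) (t : ℝ≥0∞)).toNNReal ≤ t := fun ω =>
    by
    simpa using ENNReal.toNNReal_mono ENNReal.coe_ne_top (min_le_right (τ ω) (t : ℝ≥0∞))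
  have hσ : Measurable fun ω => (min (τ ω) (t : ℝ≥0∞)).toNNReal :=
    (hτ.measurable_ennreal.min measurable_const).ennreal_toNNReal
  have h := hN.martingale_compensated.integral_min_of_rightCts
    (fun ω u => (hN.rightCts_comp (fun n => n) ω u).sub (by fun_prop)) hτ t
    -- Domination must reach `t + 1` because rounding up to the grid may overshoot `t` by one.
    (g := fun ω => N (t + 1) ω + lam * (t + 1))
    ((hN.integrable_natCast _).add (integrable_const _)) fun u hu ω => by
      have h1 : (N u ω : ℝ) ≤ N (t + 1) ω := mod_cast hN.mono ω hu
      have h2 : (lam : ℝ) * u ≤ lam * (t + 1) :=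
        mul_le_mul_of_nonneg_left (mod_cast hu) lam.coe_nonneg
      have h3 : (0 : ℝ) ≤ lam * u := by positivity
      rw [Real.norm_eq_abs, abs_le]
      constructor <;> linarith [Nat.cast_nonneg (α := ℝ) (N u ω), Nat.cast_nonneg (α := ℝ) (N (t + 1) ω)]
  have hi1 : Integrable (fun ω => (N (min (τ ω) t).toNNReal ω : ℝ)) P := by
    refine (hN.integrable_natCast t).mono' ?_ (.of_forall fun ω => ?_)
    · have := hN.measurable_uncurry.comp (hσ.prodMk measurable_id)
      exact (Measurable.comp (.of_discrete (f := fun n : ℕ => (n : ℝ))) this).aestronglyMeasurable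
    · simpa using hN.mono ω (hle ω)
  have hi2 : Integrable (fun ω => ((min (τ ω) (t : ℝ≥0∞)).toNNReal : ℝ)) P := by
    refine (integrable_const (t : ℝ)).mono'
      (hσ.coe_nnreal_real).aestronglyMeasurable (.of_forall fun ω => ?_)
    simpa using hle ω
  rw [integral_sub hi1 (hi2.const_mul _), integral_const_mul] at h
  simp only [hN.zero, Nat.cast_zero, NNReal.coe_zero, mul_zero, sub_zero, integral_zero] at h
  have h1 := ofReal_integral_eq_lintegral_ofReal hi1 (.of_forall fun ω => by positivity)
  have h2 := ofReal_integral_eq_lintegral_ofReal hi2 (.of_forall fun ω => by positivity)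
  simp only [ENNReal.ofReal_natCast, ENNReal.ofReal_coe_nnreal] at h1 h2
  rw [← h1, sub_eq_zero.1 h, ENNReal.ofReal_mul lam.coe_nonneg, h2, ENNReal.ofReal_coe_nnreal]
  simp only [ENNReal.coe_toNNReal (htop _)]

/-- Optional stopping for the martingale of `W`. Truncation at `t` makes each term integrable, so
the martingale identity separates into an equality of two finite means. -/
theorem lintegral_cumulativeWaiting_stopped_min (hN : IsPoissonProcess N lam P) (hlam : 0 < lam)
    {τ : Ω → ℝ≥0∞} (hτ : IsStoppingTime hN.filtration τ) (t : ℝ≥0) :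
    ∫⁻ ω, ENNReal.ofReal (cumulativeWaiting N (min (τ ω) t).toNNReal ω) ∂P
      = (∫⁻ ω, ENNReal.ofReal ((N (min (τ ω) t).toNNReal ω : ℝ) ^ 2
          - (N (min (τ ω) t).toNNReal ω : ℝ)) ∂P) / (2 * (lam : ℝ≥0∞)) := by
  have htop : ∀ ω, min (τ ω) (t : ℝ≥0∞) ≠ ∞ := fun ω => by simp
  have hle : ∀ ω, (min (τ ω) (t : ℝ≥0∞)).toNNReal ≤ t := fun ω =>
    by
    simpa using ENNReal.toNNReal_mono ENNReal.coe_ne_top (min_le_right (τ ω) (t : ℝ≥0∞))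
  have hσ : Measurable fun ω => (min (τ ω) (t : ℝ≥0∞)).toNNReal :=
    (hτ.measurable_ennreal.min measurable_const).ennreal_toNNReal
  have hl : (0 : ℝ) < 2 * lam := by have := NNReal.coe_pos.2 hlam; positivity
  have hsq : ∀ n : ℕ, (0 : ℝ) ≤ (n : ℝ) ^ 2 - n := fun n => by
    have : (n : ℝ) ≤ (n : ℝ) ^ 2 := mod_cast Nat.le_self_pow two_ne_zero n
    linarith
  have h := (hN.martingale_cumulativeWaiting hlam).integral_min_of_rightCts
    (fun ω u => ((hN.continuous_cumulativeWaiting ω).continuousWithinAt.sub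
      (hN.rightCts_comp (fun n => (n : ℝ) ^ 2 / (2 * lam)) ω u)).add
      (hN.rightCts_comp (fun n => (n : ℝ) / (2 * lam)) ω u)) hτ t
    (g := fun ω => cumulativeWaiting N (t + 1) ω + (N (t + 1) ω : ℝ) ^ 2 / (2 * lam)
      + (N (t + 1) ω : ℝ) / (2 * lam))
    (((hN.integrable_cumulativeWaiting _).add ((hN.integrable_sq _).div_const _)).add
      ((hN.integrable_natCast _).div_const _)) fun u hu ω => by
      have h1 : (N u ω : ℝ) ≤ N (t + 1) ω := mod_cast hN.mono ω hu
      have h1' : (N u ω : ℝ) / (2 * lam) ≤ N (t + 1) ω / (2 * lam) := by gcongr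
      have h2 : (N u ω : ℝ) ^ 2 / (2 * lam) ≤ (N (t + 1) ω : ℝ) ^ 2 / (2 * lam) := by gcongr
      have h3 := hN.cumulativeWaiting_mono ω hu
      have h4 := cumulativeWaiting_nonneg (N := N) u ω
      have h5 : (0 : ℝ) ≤ (N u ω : ℝ) ^ 2 / (2 * lam) := by positivity
      have h6 : (0 : ℝ) ≤ (N u ω : ℝ) / (2 * lam) := by positivity
      simp only at h3
      rw [Real.norm_eq_abs, abs_le]
      constructor <;> linarith
  have hNm := hN.measurable_uncurry.comp (hσ.prodMk measurable_id)
  have hi1 : Integrable (fun ω => (N (min (τ ω) t).toNNReal ω : ℝ) ^ 2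
      - (N (min (τ ω) t).toNNReal ω : ℝ)) P := by
    refine (hN.integrable_sq t).mono' ?_ (.of_forall fun ω => ?_)
    · exact (Measurable.comp (.of_discrete (f := fun n : ℕ => (n : ℝ) ^ 2 - n))
        hNm).aestronglyMeasurable
    · rw [Real.norm_of_nonneg (hsq _)]
      have h1 : (N (min (τ ω) t).toNNReal ω : ℝ) ^ 2 ≤ (N t ω : ℝ) ^ 2 :=
        mod_cast Nat.pow_le_pow_left (hN.mono ω (hle ω)) 2
      linarith [Nat.cast_nonneg (α := ℝ) (N (min (τ ω) t).toNNReal ω)]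
  have hi2 : Integrable (fun ω => cumulativeWaiting N (min (τ ω) t).toNNReal ω) P := by
    refine (hN.integrable_cumulativeWaiting t).mono'
      (hN.measurable_uncurry_cumulativeWaiting.comp
        (hσ.prodMk measurable_id)).aestronglyMeasurable (.of_forall fun ω => ?_)
    rw [Real.norm_of_nonneg (cumulativeWaiting_nonneg _ _)]
    exact hN.cumulativeWaiting_mono ω (hle ω)
  have e : ∀ ω, cumulativeWaiting N (min (τ ω) t).toNNReal ω
        - (N (min (τ ω) t).toNNReal ω : ℝ) ^ 2 / (2 * (lam : ℝ))
        + (N (min (τ ω) t).toNNReal ω : ℝ) / (2 * (lam : ℝ))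
      = cumulativeWaiting N (min (τ ω) t).toNNReal ω - ((N (min (τ ω) t).toNNReal ω : ℝ) ^ 2
          - (N (min (τ ω) t).toNNReal ω : ℝ)) / (2 * lam) := fun ω => by
    ring
  simp only [e] at h
  rw [integral_sub hi2 (hi1.div_const _), integral_div] at h
  simp only [hN.zero, cumulativeWaiting_zero, Nat.cast_zero, ne_eq, OfNat.ofNat_ne_zero,
    not_false_eq_true, zero_pow, zero_div, add_zero, sub_zero, integral_zero] at h
  rw [← ofReal_integral_eq_lintegral_ofReal hi1 (.of_forall fun ω => hsq _),
    ← ofReal_integral_eq_lintegral_ofReal hi2 (.of_forall fun ω => cumulativeWaiting_nonneg _ _),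
    sub_eq_zero.1 h, ENNReal.ofReal_div_of_pos hl, ENNReal.ofReal_mul zero_le_two,
    ENNReal.ofReal_coe_nnreal, ENNReal.ofReal_ofNat]

/-- Monotone convergence on both sides of the truncated identity; the common value may be infinite.
-/
theorem meanOrders_eq (hN : IsPoissonProcess N lam P) {τ : Ω → ℝ≥0∞}
    (hτ : IsStoppingTime hN.filtration τ) (hfin : ∀ᵐ ω ∂P, τ ω ≠ ∞) :
    meanOrders P N τ = lam * meanCycle P τ := by
  have h1 := tendsto_lintegral_min_natCast (P := P) (G := fun t ω => (N t ω : ℝ≥0∞))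
    (Measurable.comp .of_discrete hN.measurable_uncurry)
    (fun ω s t hst => Nat.cast_le.2 (hN.mono ω hst)) hτ.measurable_ennreal hfin
  have h2 := tendsto_lintegral_min_natCast (P := P) (G := fun t (_ : Ω) => (t : ℝ≥0∞))
    (by fun_prop) (fun ω s t hst => ENNReal.coe_le_coe.2 hst) hτ.measurable_ennreal hfin
  have e : ∫⁻ ω, stoppedValue (ι := ℝ≥0) (fun t (_ : Ω) => (t : ℝ≥0∞)) τ ω ∂P = meanCycle P τ := by
    refine lintegral_congr_ae ?_
    filter_upwards [hfin] with ω hω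
    rw [stoppedValue_eq_toNNReal hω, ENNReal.coe_toNNReal hω]
  rw [e] at h2
  refine tendsto_nhds_unique h1 ((ENNReal.Tendsto.const_mul h2 (.inr ENNReal.coe_ne_top)).congr
    fun n => ?_)
  rw [hN.lintegral_stopped_min hτ]
  simp only [ENNReal.coe_toNNReal (a := min (τ _) ((n : ℝ≥0) : ℝ≥0∞)) (by simp)]

theorem meanWaiting_eq (hN : IsPoissonProcess N lam P) (hlam : 0 < lam) {τ : Ω → ℝ≥0∞}
    (hτ : IsStoppingTime hN.filtration τ) (hfin : ∀ᵐ ω ∂P, τ ω ≠ ∞) :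
    meanWaiting P N τ = meanOrdersSqSub P N τ / (2 * (lam : ℝ≥0∞)) := by
  have h1 := tendsto_lintegral_min_natCast (P := P)
    (G := fun t ω => ENNReal.ofReal (cumulativeWaiting N t ω))
    hN.measurable_uncurry_cumulativeWaiting.ennreal_ofReal
    (fun ω s t hst => ENNReal.ofReal_le_ofReal (hN.cumulativeWaiting_mono ω hst))
    hτ.measurable_ennreal hfin
  have hm : Measurable fun p : ℝ≥0 × Ω => ENNReal.ofReal ((N p.1 p.2 : ℝ) ^ 2 - (N p.1 p.2 : ℝ)) :=
    (Measurable.of_discrete (f := fun n : ℕ => ENNReal.ofReal ((n : ℝ) ^ 2 - n))).comp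
      hN.measurable_uncurry
  have h2 := tendsto_lintegral_min_natCast (P := P)
    (G := fun t ω => ENNReal.ofReal ((N t ω : ℝ) ^ 2 - (N t ω : ℝ)))
    hm
    (fun ω s t hst => ENNReal.ofReal_le_ofReal (by
      have h : N s ω ≤ N t ω := hN.mono ω hst
      have h' : (N s ω : ℝ) ≤ N t ω := mod_cast h
      -- `x² - x` is not monotone on `[0, 1]`, only along the naturals, so `N t = 0` is treated
      -- apart.
      rcases Nat.eq_zero_or_pos (N t ω) with h0 | h0
      · have hs0 : N s ω = 0 := by omega
        simp only [h0, hs0, le_refl]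
      · have : (1 : ℝ) ≤ N t ω := mod_cast h0
        nlinarith [Nat.cast_nonneg (α := ℝ) (N s ω)])) hτ.measurable_ennreal hfin
  refine tendsto_nhds_unique h1 ((ENNReal.Tendsto.div_const h2 (.inr ?_)).congr fun n => ?_)
  · simpa using hlam.ne'
  · rw [hN.lintegral_cumulativeWaiting_stopped_min hlam hτ]

end IsPoissonProcess

/-! ### Arrival times and absence of double jumps. -/

theorem MeasureTheory.IsStoppingTime.add_coe {Ω : Type*} [mΩ : MeasurableSpace Ω]
    {ℱ : Filtration ℝ≥0 mΩ} {τ : Ω → ℝ≥0∞} (hτ : IsStoppingTime ℱ τ) (T : ℝ≥0) :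
    IsStoppingTime ℱ (fun ω => τ ω + (T : ℝ≥0∞)) := by
  intro t
  change MeasurableSet[ℱ t] {ω | τ ω + (T : ℝ≥0∞) ≤ (t : ℝ≥0∞)}
  by_cases h : T ≤ t
  · have e : {ω | τ ω + (T : ℝ≥0∞) ≤ (t : ℝ≥0∞)} = {ω | τ ω ≤ ((t - T : ℝ≥0) : ℝ≥0∞)} := by
      ext ω
      rw [Set.mem_ofPred_eq, Set.mem_ofPred_eq, ENNReal.coe_sub,
        ENNReal.le_sub_iff_add_le_right ENNReal.coe_ne_top (ENNReal.coe_le_coe.2 h)]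
    rw [e]
    exact ℱ.mono tsub_le_self _ (hτ (t - T))
  · convert! MeasurableSet.empty
    ext ω
    simp only [Set.mem_ofPred_eq, Set.mem_empty_iff_false, iff_false]
    exact fun h' => h (ENNReal.coe_le_coe.1 (le_add_self.trans h'))

namespace IsPoissonProcess

variable {Ω : Type*} [mΩ : MeasurableSpace Ω] {N : ℝ≥0 → Ω → ℕ} {lam : ℝ≥0} {P : Measure Ω}

theorem measure_increment_preimage (hN : IsPoissonProcess N lam P) {s t : ℝ≥0} (hst : s ≤ t)
    (B : Set ℕ) : P ((fun ω => N t ω - N s ω) ⁻¹' B) = poissonMeasure (lam * (t - s)) B := by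
  rw [← (hN.law_increment s t hst).map_eq,
    Measure.map_apply (hN.measurable_increment s t) .of_discrete]

/-- Right-continuity makes the infimum attained: level `q` is reached before every `u > t`, and `u`
decreases to `t`. -/
theorem arrivalTime_le_iff (hN : IsPoissonProcess N lam P) (q : ℕ) (t : ℝ≥0) (ω : Ω) :
    arrivalTime N q ω ≤ (t : ℝ≥0∞) ↔ q ≤ N t ω := by
  constructor
  · intro h
    have hlim : Tendsto (fun u => N u ω) (𝓝[>] t) (𝓝 (N t ω)) :=
      (hN.rightCts ω t).mono_left (nhdsWithin_mono _ Set.Ioi_subset_Ici_self)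
    refine ge_of_tendsto hlim ?_
    filter_upwards [self_mem_nhdsWithin] with u hu
    obtain ⟨j, hj, hq⟩ := hittingAfter_lt_iff.1 (h.trans_lt (ENNReal.coe_lt_coe.2 hu))
    exact le_trans hq (hN.mono ω hj.2.le)
  · exact fun h => hittingAfter_le_of_mem (u := N) (s := Set.Ici q) zero_le h

theorem le_natCast_arrivalTime (hN : IsPoissonProcess N lam P) (q : ℕ) {ω : Ω}
    (h : arrivalTime N q ω ≠ ∞) : q ≤ N (arrivalTime N q ω).toNNReal ω := by
  rw [← hN.arrivalTime_le_iff, ENNReal.coe_toNNReal h]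

theorem isStoppingTime_arrivalTime (hN : IsPoissonProcess N lam P) (q : ℕ) :
    IsStoppingTime hN.filtration (arrivalTime N q) := by
  intro t
  have e : {ω | arrivalTime N q ω ≤ (t : ℝ≥0∞)} = N t ⁻¹' Set.Ici q := by
    ext ω
    exact hN.arrivalTime_le_iff q t ω
  exact e ▸ hN.measurable_filtration le_rfl .of_discrete

/-- Almost surely the process has no jump of height larger than one. -/
theorem ae_natCast_arrivalTime (hN : IsPoissonProcess N lam P) : ∀ᵐ ω ∂P, ∀ q : ℕ, 1 ≤ q →
    arrivalTime N q ω ≠ ∞ → N (arrivalTime N q ω).toNNReal ω = q := by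
  -- If level `q` is overshot before time `M`, the grid cell of width `1/(n+1)` containing the
  -- arrival carries an increment of at least two. Each of the `M(n+1)` cells does so with
  -- probability at most `(λ/(n+1))²`, so the union bound `Mλ²/(n+1)` tends to zero.
  have key : ∀ q M : ℕ, 1 ≤ q → P {ω | arrivalTime N q ω ≤ ((M : ℝ≥0) : ℝ≥0∞) ∧
      q + 1 ≤ N (arrivalTime N q ω).toNNReal ω} = 0 := by
    intro q M hq
    have hbound : ∀ n : ℕ, P {ω | arrivalTime N q ω ≤ ((M : ℝ≥0) : ℝ≥0∞) ∧
        q + 1 ≤ N (arrivalTime N q ω).toNNReal ω}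
          ≤ ENNReal.ofReal (M * (lam : ℝ) ^ 2 * (1 / ((n : ℝ) + 1))) := by
      intro n
      have hn : (0 : ℝ≥0) < n + 1 := by positivity
      have hstep : ∀ i : ℕ, (i : ℝ≥0) / (n + 1) ≤ ((i + 1 : ℕ) : ℝ≥0) / (n + 1) := fun i => by
        gcongr
        exact Nat.le_succ i
      have hsub : {ω | arrivalTime N q ω ≤ ((M : ℝ≥0) : ℝ≥0∞) ∧
          q + 1 ≤ N (arrivalTime N q ω).toNNReal ω} ⊆ ⋃ i ∈ Finset.range (M * (n + 1)),
            (fun ω => N (((i + 1 : ℕ) : ℝ≥0) / (n + 1)) ω - N ((i : ℝ≥0) / (n + 1)) ω) ⁻¹'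
              Set.Ici 2 := by
        rintro ω ⟨hM, hq1⟩
        have htop : arrivalTime N q ω ≠ ∞ := (hM.trans_lt ENNReal.coe_lt_top).ne
        set a := (arrivalTime N q ω).toNNReal with ha
        have hac : arrivalTime N q ω = (a : ℝ≥0∞) := (ENNReal.coe_toNNReal htop).symm
        rw [hac, ENNReal.coe_le_coe] at hM
        -- A positive arrival time lies in a half-open cell whose left endpoint is strictly earlier,
        -- where the level is still below `q`.
        have ha0 : 0 < a := by
          rw [pos_iff_ne_zero]
          intro h0
          rw [h0, hN.zero] at hq1
          omega
        obtain ⟨i, hi⟩ : ∃ i, ⌈(n + 1 : ℝ≥0) * a⌉₊ = i + 1 :=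
          Nat.exists_eq_succ_of_ne_zero (Nat.ceil_pos.2 (by positivity)).ne'
        have h1 : a ≤ ((i + 1 : ℕ) : ℝ≥0) / (n + 1) := by
          have := le_ceilGrid n a
          rwa [ceilGrid, hi] at this
        have h2 : (i : ℝ≥0) / (n + 1) < a := by
          rw [div_lt_iff₀ hn, mul_comm]
          exact Nat.lt_ceil.1 (hi ▸ Nat.lt_succ_self i)
        have h3 : i < M * (n + 1) := by
          have : ⌈(n + 1 : ℝ≥0) * a⌉₊ ≤ M * (n + 1) := by
            rw [Nat.ceil_le]
            push_cast
            rw [mul_comm]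
            gcongr
          omega
        have h4 : N ((i : ℝ≥0) / (n + 1)) ω < q := by
          by_contra! h
          rw [← hN.arrivalTime_le_iff, hac, ENNReal.coe_le_coe] at h
          exact absurd h2 h.not_gt
        have h5 := hN.mono ω h1
        simp only at h5
        simp only [Set.mem_iUnion, Finset.mem_range, Set.mem_preimage, Set.mem_Ici]
        exact ⟨i, h3, by omega⟩
      refine (measure_mono hsub).trans ((measure_biUnion_finset_le _ _).trans ?_)
      have hterm : ∀ i ∈ Finset.range (M * (n + 1)),
          P ((fun ω => N (((i + 1 : ℕ) : ℝ≥0) / (n + 1)) ω - N ((i : ℝ≥0) / (n + 1)) ω) ⁻¹'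
            Set.Ici 2) ≤ ENNReal.ofReal (((lam : ℝ) / (n + 1)) ^ 2) := by
        intro i _
        rw [hN.measure_increment_preimage (hstep i)]
        refine (poissonMeasure_Ici_two_le _).trans_eq ?_
        congr 2
        rw [NNReal.coe_mul, NNReal.coe_sub (hstep i)]
        push_cast
        ring
      refine (Finset.sum_le_sum hterm).trans_eq ?_
      rw [Finset.sum_const, Finset.card_range, nsmul_eq_mul, ← ENNReal.ofReal_natCast,
        ← ENNReal.ofReal_mul (by positivity)]
      congr 1
      push_cast
      field_simp
    have h := (tendsto_one_div_add_atTop_nhds_zero_nat (𝕜 := ℝ)).const_mul (M * (lam : ℝ) ^ 2)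
    rw [mul_zero] at h
    refine le_antisymm ?_ zero_le
    simpa using ge_of_tendsto' (ENNReal.tendsto_ofReal h) hbound
  have h : ∀ᵐ ω ∂P, ∀ q M : ℕ, 1 ≤ q → ¬ (arrivalTime N q ω ≤ ((M : ℝ≥0) : ℝ≥0∞) ∧
      q + 1 ≤ N (arrivalTime N q ω).toNNReal ω) := by
    refine ae_all_iff.2 fun q => ae_all_iff.2 fun M => ?_
    by_cases hq : 1 ≤ q
    · filter_upwards [ae_iff.2 (by simpa using key q M hq :
        P {ω | ¬ ¬ (arrivalTime N q ω ≤ ((M : ℝ≥0) : ℝ≥0∞) ∧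
          q + 1 ≤ N (arrivalTime N q ω).toNNReal ω)} = 0)] with ω hω _ using hω
    · exact .of_forall fun ω hq' => absurd hq' hq
  filter_upwards [h] with ω hω q hq htop
  obtain ⟨M, hM⟩ := exists_nat_ge (arrivalTime N q ω).toNNReal
  refine le_antisymm ?_ (hN.le_natCast_arrivalTime q htop)
  by_contra! h
  refine hω q M hq ⟨?_, h⟩
  rw [← ENNReal.coe_toNNReal htop]
  exact ENNReal.coe_le_coe.2 hM

variable [IsProbabilityMeasure P]

/-! ### Poisson increments after a stopping time, and finiteness of arrival times. -/

/-- The strong Markov property at the one-dimensional level: after an almost surely finite stopping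
time the increments still have the Poisson law. -/
theorem hasLaw_increment_stoppingTime (hN : IsPoissonProcess N lam P) {τ : Ω → ℝ≥0∞}
    (hτ : IsStoppingTime hN.filtration τ) (hfin : ∀ᵐ ω ∂P, τ ω ≠ ∞) (T : ℝ≥0) :
    HasLaw (fun ω => N ((τ ω).toNNReal + T) ω - N (τ ω).toNNReal ω)
      (poissonMeasure (lam * T)) P := by
  have hm : ∀ {σ : Ω → ℝ≥0}, Measurable σ → Measurable fun ω => N (σ ω + T) ω - N (σ ω) ω :=
    fun hσ => (hN.measurable_uncurry.comp ((hσ.add_const T).prodMk measurable_id)).sub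
      (hN.measurable_uncurry.comp (hσ.prodMk measurable_id))
  have hτm : Measurable fun ω => (τ ω).toNNReal := hτ.measurable_ennreal.ennreal_toNNReal
  -- For the rounded time, split by its value `t j`: that event lies in the past of `t j`, hence is
  -- independent of the increment from `t j` to `t j + T`, whose law does not depend on `j`.
  have hgrid : ∀ (n k : ℕ), P ((fun ω => N (ceilGrid n (τ ω).toNNReal + T) ω
      - N (ceilGrid n (τ ω).toNNReal) ω) ⁻¹' {k}) = poissonMeasure (lam * T) {k} := by
    intro n k
    set t : ℕ → ℝ≥0 := fun j => (j : ℝ≥0) / (n + 1) with ht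
    have htinj : Function.Injective t := fun i j hij => by
      have h : (n + 1 : ℝ≥0) ≠ 0 := by positivity
      exact_mod_cast (div_left_inj' h).1 hij
    set A : ℕ → Set Ω := fun j => {ω | WithTop.map (ceilGrid n) (τ ω) = (t j : WithTop ℝ≥0)} with hA
    have hA' : ∀ j ω, ω ∈ A j ↔ τ ω ≠ ∞ ∧ ceilGrid n (τ ω).toNNReal = t j := by
      intro j ω
      change WithTop.map (ceilGrid n) (τ ω) = (t j : WithTop ℝ≥0) ↔ _
      generalize τ ω = a
      induction a with
      | top => exact iff_of_false WithTop.top_ne_coe fun h => h.1 rfl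
      | coe a => exact WithTop.coe_inj.trans (by simp)
    have hAm : ∀ j, MeasurableSet[hN.filtration (t j)] (A j) := fun j =>
      (IsStoppingTime.map_ceilGrid hτ n).measurableSet_eq (t j)
    set B : ℕ → Set Ω := fun j => (fun ω => N (t j + T) ω - N (t j) ω) ⁻¹' {k} with hB
    have hBm : ∀ j, MeasurableSet (B j) := fun j => hN.measurable_increment _ _ .of_discrete
    have hAB : ∀ j, P (A j ∩ B j) = P (A j) * poissonMeasure (lam * T) {k} := by
      intro j
      rw [(Indep_iff _ _ _).1 (hN.indep_filtration_increment (t := t j + T) le_self_add) (A j) (B j)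
        (hAm j) ⟨{k}, .of_discrete, rfl⟩, hN.measure_increment_preimage le_self_add,
        add_tsub_cancel_left]
    have hdisj : Pairwise (Function.onFun Disjoint A) := fun i j hij =>
      Set.disjoint_left.2 fun ω hi hj =>
        hij (htinj (((hA' i ω).1 hi).2.symm.trans ((hA' j ω).1 hj).2))
    have hex : ∀ ω, τ ω ≠ ∞ → ∃ j, ω ∈ A j := fun ω hω =>
      ⟨_, (hA' ⌈(n + 1 : ℝ≥0) * (τ ω).toNNReal⌉₊ ω).2 ⟨hω, rfl⟩⟩
    have h1 : P (⋃ j, A j) = 1 := by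
      rw [prob_compl_eq_zero_iff (.iUnion fun j => hN.filtration.le _ _ (hAm j)) |>.symm]
      refine measure_mono_null (fun ω hω => ?_) (ae_iff.1 hfin)
      by_contra hω'
      exact hω (Set.mem_iUnion.2 (hex ω (by simpa using hω')))
    have h2 : P ((fun ω => N (ceilGrid n (τ ω).toNNReal + T) ω
        - N (ceilGrid n (τ ω).toNNReal) ω) ⁻¹' {k}) = P (⋃ j, A j ∩ B j) := by
      refine measure_congr ?_
      filter_upwards [hfin] with ω hω
      refine propext ⟨fun h => ?_, fun h => ?_⟩
      · obtain ⟨j, hj⟩ := hex ω hω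
        refine Set.mem_iUnion.2 ⟨j, hj, ?_⟩
        have h' : N (ceilGrid n (τ ω).toNNReal + T) ω - N (ceilGrid n (τ ω).toNNReal) ω = k := h
        rwa [((hA' j ω).1 hj).2] at h'
      · obtain ⟨j, hj, hk⟩ := Set.mem_iUnion.1 h
        change N (ceilGrid n (τ ω).toNNReal + T) ω - N (ceilGrid n (τ ω).toNNReal) ω = k
        rw [((hA' j ω).1 hj).2]
        exact hk
    rw [h2, measure_iUnion (fun i j hij => (hdisj hij).mono Set.inter_subset_left
      Set.inter_subset_left) (fun j => (hN.filtration.le _ _ (hAm j)).inter (hBm j))]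
    simp only [hAB]
    rw [ENNReal.tsum_mul_right, ← measure_iUnion hdisj fun j => hN.filtration.le _ _ (hAm j), h1,
      one_mul]
  refine ⟨(hm hτm).aemeasurable, Measure.ext_of_singleton fun k => ?_⟩
  rw [Measure.map_apply (hm hτm) .of_discrete]
  refine tendsto_nhds_unique (tendsto_measure_of_tendsto_indicator_of_isFiniteMeasure atTop P
    (fun n => hm ((measurable_ceilGrid n).comp hτm) .of_discrete) fun ω => ?_)
    (tendsto_const_nhds.congr fun n => (hgrid n k).symm)
  -- For integer values, convergence from the right means eventual equality, so the indicators of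
  -- the events converge pointwise.
  have hev : ∀ s : ℝ≥0, ∀ᶠ n in atTop, N (ceilGrid n (τ ω).toNNReal + s) ω
      = N ((τ ω).toNNReal + s) ω := by
    intro s
    have hlim : Tendsto (fun n => ceilGrid n (τ ω).toNNReal + s) atTop
        (𝓝[≥] ((τ ω).toNNReal + s)) :=
      tendsto_nhdsWithin_iff.2 ⟨(tendsto_nhdsWithin_iff.1 (tendsto_ceilGrid _)).1.add_const s,
        .of_forall fun n => add_le_add_left (le_ceilGrid n _) s⟩
    have h := Tendsto.comp (g := fun u => N u ω) (hN.rightCts ω _) hlim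
    rw [nhds_discrete, tendsto_pure] at h
    exact h
  filter_upwards [hev T, hev 0] with n h1 h2
  simp only [add_zero] at h2
  simp only [Set.mem_preimage, Function.comp, h1, h2]

/-- Without overshoot the count at `min τ_q n` is at most `q`, so the truncated Wald identity bounds
`E[min τ_q n]` by `q/λ` uniformly in `n`. -/
theorem ae_arrivalTime_ne_top (hN : IsPoissonProcess N lam P) (hlam : 0 < lam) {q : ℕ}
    (hq : 1 ≤ q) : ∀ᵐ ω ∂P, arrivalTime N q ω ≠ ∞ := by
  have hτ := hN.isStoppingTime_arrivalTime q
  have hbd : ∀ n : ℕ, ∫⁻ ω, min (arrivalTime N q ω) ((n : ℝ≥0) : ℝ≥0∞) ∂P ≤ q / lam := by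
    intro n
    rw [ENNReal.le_div_iff_mul_le (.inl (by simpa using hlam.ne')) (.inl ENNReal.coe_ne_top),
      mul_comm, ← hN.lintegral_stopped_min hτ]
    have h : ∀ᵐ ω ∂P, (N (min (arrivalTime N q ω) ((n : ℝ≥0) : ℝ≥0∞)).toNNReal ω : ℝ≥0∞) ≤ q := by
      filter_upwards [hN.ae_natCast_arrivalTime] with ω hω
      rw [Nat.cast_le]
      rcases le_or_gt (arrivalTime N q ω) ((n : ℝ≥0) : ℝ≥0∞) with h | h
      · rw [min_eq_left h]
        exact (hω q hq (h.trans_lt ENNReal.coe_lt_top).ne).le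
      · rw [min_eq_right h.le, ENNReal.toNNReal_coe]
        rw [← not_le, hN.arrivalTime_le_iff] at h
        omega
    exact (lintegral_mono_ae h).trans_eq (by simp)
  have hlim : Tendsto (fun n : ℕ => ∫⁻ ω, min (arrivalTime N q ω) ((n : ℝ≥0) : ℝ≥0∞) ∂P) atTop
      (𝓝 (∫⁻ ω, arrivalTime N q ω ∂P)) := by
    refine lintegral_tendsto_of_tendsto_of_monotone
      (fun n => (hτ.measurable_ennreal.min measurable_const).aemeasurable)
      (.of_forall fun ω m n hmn => min_le_min_left _ (mod_cast hmn)) (.of_forall fun ω => ?_)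
    simpa using tendsto_const_nhds.min ENNReal.tendsto_nat_nhds_top
  have hfin : ∫⁻ ω, arrivalTime N q ω ∂P ≠ ∞ :=
    ((le_of_tendsto' hlim hbd).trans_lt (ENNReal.div_lt_top (by simp) (by simpa using hlam.ne'))).ne
  filter_upwards [ae_lt_top hτ.measurable_ennreal hfin] with ω hω using hω.ne

end IsPoissonProcess

/-! ### The five clearing policies. -/

theorem integrable_min_natCast_poissonMeasure (r : ℝ≥0) (k : ℕ) (f : ℕ → ℝ) :
    Integrable (fun n : ℕ => f (min n k)) (poissonMeasure r) := by
  refine Integrable.of_bound .of_discrete (∑ i ∈ Finset.range (k + 1), ‖f i‖) (.of_forall fun n => ?_)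
  exact Finset.single_le_sum (f := fun i => ‖f i‖) (fun i _ => norm_nonneg _)
    (Finset.mem_range.2 (by omega))

/-- The atom at `1` already contributes. Positivity is needed to turn the quotient in `[0, ∞]` into
a real one. -/
theorem integral_min_natCast_poissonMeasure_pos {r : ℝ≥0} (hr : 0 < r) {k : ℕ} (hk : 1 ≤ k) :
    0 < ∫ n, ((min n k : ℕ) : ℝ) ∂(poissonMeasure r) := by
  rw [integral_pos_iff_support_of_nonneg (fun n => Nat.cast_nonneg _)
    (integrable_min_natCast_poissonMeasure r k fun n => n)]
  have h1 : 0 < poissonMeasure r {1} := by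
    have := poissonMeasure_real_singleton_pos 1 hr
    exact (ENNReal.toReal_pos_iff.1 this).1
  refine h1.trans_le (measure_mono ?_)
  rintro _ rfl
  simp only [Function.mem_support]
  have : min 1 k = 1 := by omega
  simp [this]

namespace IsPoissonProcess

variable {Ω : Type*} [mΩ : MeasurableSpace Ω] {N : ℝ≥0 → Ω → ℕ} {lam : ℝ≥0} {P : Measure Ω}
  [IsProbabilityMeasure P]

theorem meanCycle_eq (hN : IsPoissonProcess N lam P) (hlam : 0 < lam) {τ : Ω → ℝ≥0∞}
    (hτ : IsStoppingTime hN.filtration τ) (hfin : ∀ᵐ ω ∂P, τ ω ≠ ∞) :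
    meanCycle P τ = meanOrders P N τ / lam := by
  rw [hN.meanOrders_eq hτ hfin, mul_comm, ENNReal.mul_div_cancel_right
    (by simpa using hlam.ne') ENNReal.coe_ne_top]

/-- The performance measures of a release time at which the number of orders is almost surely a
function of a Poisson random variable. -/
theorem policy_means (hN : IsPoissonProcess N lam P) (hlam : 0 < lam) {τ : Ω → ℝ≥0∞}
    (hτ : IsStoppingTime hN.filtration τ) (hfin : ∀ᵐ ω ∂P, τ ω ≠ ∞) {D : Ω → ℕ} {r : ℝ≥0}
    (hD : HasLaw D (poissonMeasure r) P) {f : ℕ → ℕ}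
    (hval : ∀ᵐ ω ∂P, N (τ ω).toNNReal ω = f (D ω))
    (hf : Integrable (fun n => (f n : ℝ)) (poissonMeasure r))
    (hf2 : Integrable (fun n => (f n : ℝ) * (f n - 1)) (poissonMeasure r)) {a b : ℝ}
    (ha : ∫ n, (f n : ℝ) * (f n - 1) ∂(poissonMeasure r) = a)
    (hb : ∫ n, (f n : ℝ) ∂(poissonMeasure r) = b) (hb0 : 0 < b) :
    meanWaiting P N τ = ENNReal.ofReal (a / (2 * lam)) ∧
    meanCycle P τ = ENNReal.ofReal (b / lam) ∧
    averageOrderDelay P N τ = ENNReal.ofReal (a / (2 * lam) / b) := by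
  have hl : (0 : ℝ) < lam := hlam
  have hvalue : ∀ᵐ ω ∂P, stoppedValue (ι := ℝ≥0) N τ ω = f (D ω) := by
    filter_upwards [hval, hfin] with ω h1 h2
    rw [stoppedValue_eq_toNNReal h2, h1]
  have hsq : ∀ n : ℕ, (0 : ℝ) ≤ (n : ℝ) * (n - 1) := by
    rintro (_ | n)
    · simp
    · push_cast; simp; positivity
  have horders : meanOrders P N τ = ENNReal.ofReal b := by
    rw [← hb, ofReal_integral_eq_lintegral_ofReal hf (.of_forall fun n => by positivity),
      ← hD.lintegral_comp .of_discrete]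
    refine lintegral_congr_ae ?_
    filter_upwards [hvalue] with ω hω
    rw [hω, ENNReal.ofReal_natCast]
  have hordersSq : meanOrdersSqSub P N τ = ENNReal.ofReal a := by
    rw [← ha, ofReal_integral_eq_lintegral_ofReal hf2 (.of_forall fun n => hsq _),
      ← hD.lintegral_comp .of_discrete]
    refine lintegral_congr_ae ?_
    filter_upwards [hvalue] with ω hω
    rw [hω, show ((f (D ω) : ℝ)) ^ 2 - f (D ω) = f (D ω) * (f (D ω) - 1) by ring]
  have hW : meanWaiting P N τ = ENNReal.ofReal (a / (2 * lam)) := by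
    rw [hN.meanWaiting_eq hlam hτ hfin, hordersSq, ENNReal.ofReal_div_of_pos (by positivity),
      ENNReal.ofReal_mul zero_le_two, ENNReal.ofReal_coe_nnreal, ENNReal.ofReal_ofNat]
  refine ⟨hW, ?_, ?_⟩
  · rw [hN.meanCycle_eq hlam hτ hfin, horders, ENNReal.ofReal_div_of_pos hl,
      ENNReal.ofReal_coe_nnreal]
  · rw [averageOrderDelay, hW, horders, ← ENNReal.ofReal_div_of_pos hb0]

theorem policyQP_means (hN : IsPoissonProcess N lam P) (hlam : 0 < lam) {q : ℕ} (hq : 1 ≤ q) :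
    IsStoppingTime hN.filtration (policyQP N q) ∧
    meanWaiting P N (policyQP N q)
      = ENNReal.ofReal ((q : ℝ) * ((q : ℝ) - 1) / (2 * (lam : ℝ))) ∧
    meanCycle P (policyQP N q) = ENNReal.ofReal ((q : ℝ) / (lam : ℝ)) ∧
    averageOrderDelay P N (policyQP N q) = ENNReal.ofReal (((q : ℝ) - 1) / (2 * (lam : ℝ))) := by
  have hτ : IsStoppingTime hN.filtration (policyQP N q) := hN.isStoppingTime_arrivalTime q
  have hfin : ∀ᵐ ω ∂P, policyQP N q ω ≠ ∞ := hN.ae_arrivalTime_ne_top hlam hq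
  have hval : ∀ᵐ ω ∂P, N (policyQP N q ω).toNNReal ω = q := by
    filter_upwards [hfin, hN.ae_natCast_arrivalTime] with ω h1 h2 using h2 q hq h1
  have hq0 : (0 : ℝ) < q := mod_cast hq
  have hl : (0 : ℝ) < lam := hlam
  obtain ⟨h1, h2, h3⟩ := hN.policy_means hlam hτ hfin (hN.hasLaw 0) (f := fun _ => q) hval
    (integrable_const _) (integrable_const _) (a := (q : ℝ) * (q - 1)) (b := q) (by simp) (by simp)
    hq0
  refine ⟨hτ, h1, h2, h3.trans (congrArg ENNReal.ofReal ?_)⟩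
  field_simp

theorem policyTP1_means (hN : IsPoissonProcess N lam P) (hlam : 0 < lam) {T : ℝ≥0} (hT : 0 < T) :
    IsStoppingTime hN.filtration (policyTP1 Ω T) ∧
    meanWaiting P N (policyTP1 Ω T) = ENNReal.ofReal ((lam : ℝ) * (T : ℝ) ^ 2 / 2) ∧
    meanCycle P (policyTP1 Ω T) = ENNReal.ofReal (T : ℝ) ∧
    averageOrderDelay P N (policyTP1 Ω T) = ENNReal.ofReal ((T : ℝ) / 2) := by
  have hτ : IsStoppingTime hN.filtration (policyTP1 Ω T) := isStoppingTime_const _ T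
  have hl : (0 : ℝ) < lam := hlam
  have hT0 : (0 : ℝ) < T := hT
  obtain ⟨h1, h2, h3⟩ := hN.policy_means hlam hτ (.of_forall fun ω => ENNReal.coe_ne_top)
    (hN.hasLaw T) (f := fun n => n) (.of_forall fun ω => rfl)
    (integrable_natCast_poissonMeasure _).1 (integrable_natCast_mul_sub_one_poissonMeasure _).1
    (integrable_natCast_mul_sub_one_poissonMeasure _).2 (integrable_natCast_poissonMeasure _).2
    (by rw [NNReal.coe_mul]; positivity)
  rw [NNReal.coe_mul] at h1 h2 h3
  refine ⟨hτ, h1.trans (congrArg _ ?_), h2.trans (congrArg _ ?_), h3.trans (congrArg _ ?_)⟩ <;>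
    field_simp

theorem policyHP1_means (hN : IsPoissonProcess N lam P) (hlam : 0 < lam) {q : ℕ} (hq : 1 ≤ q)
    {T : ℝ≥0} (hT : 0 < T) :
    IsStoppingTime hN.filtration (policyHP1 N q T) ∧
    meanWaiting P N (policyHP1 N q T) = ENNReal.ofReal
      (truncPoissonMean (lam * T) q (fun y => y * (y - 1)) / (2 * (lam : ℝ))) ∧
    meanCycle P (policyHP1 N q T)
      = ENNReal.ofReal (truncPoissonMean (lam * T) q (fun y => y) / (lam : ℝ)) ∧
    averageOrderDelay P N (policyHP1 N q T) = ENNReal.ofReal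
      (truncPoissonMean (lam * T) q (fun y => y * (y - 1)) / (2 * (lam : ℝ))
        / truncPoissonMean (lam * T) q (fun y => y)) := by
  have hτ : IsStoppingTime hN.filtration (policyHP1 N q T) :=
    (hN.isStoppingTime_arrivalTime q).min_coe T
  have hfin : ∀ ω, policyHP1 N q T ω ≠ ∞ := fun ω => by simp [policyHP1]
  -- Level `q` is reached by time `T` exactly when `q ≤ N T`, and then it is hit without overshoot.
  have hval : ∀ᵐ ω ∂P, N (policyHP1 N q T ω).toNNReal ω = min (N T ω) q := by
    filter_upwards [hN.ae_natCast_arrivalTime] with ω hω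
    rcases le_or_gt (arrivalTime N q ω) T with h | h
    · rw [policyHP1, min_eq_left h, hω q hq (h.trans_lt ENNReal.coe_lt_top).ne,
        min_eq_right ((hN.arrivalTime_le_iff q T ω).1 h)]
    · rw [policyHP1, min_eq_right h.le, ENNReal.toNNReal_coe]
      rw [← not_le, hN.arrivalTime_le_iff] at h
      omega
  exact ⟨hτ, hN.policy_means hlam hτ (.of_forall hfin) (hN.hasLaw T) (f := fun n => min n q) hval
    (integrable_min_natCast_poissonMeasure _ q fun n => n)
    (integrable_min_natCast_poissonMeasure _ q fun n => (n : ℝ) * (n - 1)) rfl rfl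
    (integral_min_natCast_poissonMeasure_pos (mul_pos hlam hT) hq)⟩

theorem policyTP2_means (hN : IsPoissonProcess N lam P) (hlam : 0 < lam) (T : ℝ≥0) :
    IsStoppingTime hN.filtration (policyTP2 N T) ∧
    meanWaiting P N (policyTP2 N T) = ENNReal.ofReal ((lam : ℝ) * (T : ℝ) ^ 2 / 2 + (T : ℝ)) ∧
    meanCycle P (policyTP2 N T) = ENNReal.ofReal (1 / (lam : ℝ) + (T : ℝ)) ∧
    averageOrderDelay P N (policyTP2 N T)
      = ENNReal.ofReal (((T : ℝ) + (lam : ℝ) * (T : ℝ) ^ 2 / 2) / (1 + (lam : ℝ) * (T : ℝ))) := by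
  have hτ1 := hN.isStoppingTime_arrivalTime 1
  have hτ : IsStoppingTime hN.filtration (policyTP2 N T) := hτ1.add_coe T
  have hfin1 := hN.ae_arrivalTime_ne_top hlam le_rfl
  have hfin : ∀ᵐ ω ∂P, policyTP2 N T ω ≠ ∞ := by
    filter_upwards [hfin1] with ω hω using by simpa [policyTP2] using hω
  have hl : (0 : ℝ) < lam := hlam
  -- The first order plus a Poisson number of orders in the following `T` units of time.
  have hval : ∀ᵐ ω ∂P, N (policyTP2 N T ω).toNNReal ω = (N ((arrivalTime N 1 ω).toNNReal + T) ω
      - N (arrivalTime N 1 ω).toNNReal ω) + 1 := by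
    filter_upwards [hfin1, hN.ae_natCast_arrivalTime] with ω h1 h2
    have h3 := hN.mono ω (le_self_add (a := (arrivalTime N 1 ω).toNNReal) (b := T))
    simp only at h3
    rw [policyTP2, ENNReal.toNNReal_add h1 ENNReal.coe_ne_top, ENNReal.toNNReal_coe]
    rw [h2 1 le_rfl h1] at h3 ⊢
    omega
  obtain ⟨hi1, he1⟩ := integrable_natCast_poissonMeasure (lam * T)
  obtain ⟨hi2, he2⟩ := integrable_natCast_mul_sub_one_poissonMeasure (lam * T)
  have e : ∀ n : ℕ, ((n + 1 : ℕ) : ℝ) * (((n + 1 : ℕ) : ℝ) - 1)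
      = (n : ℝ) * (n - 1) + 2 * n := fun n => by
    push_cast
    ring
  obtain ⟨h1, h2, h3⟩ := hN.policy_means hlam hτ hfin (hN.hasLaw_increment_stoppingTime hτ1 hfin1 T)
    (f := fun n => n + 1) hval (a := ((lam * T : ℝ≥0) : ℝ) ^ 2 + 2 * (lam * T : ℝ≥0))
    (b := (lam * T : ℝ≥0) + 1)
    (by simpa using hi1.add (integrable_const 1))
    (by simp only [e]; exact hi2.add (hi1.const_mul 2))
    (by simp only [e]; rw [integral_add hi2 (hi1.const_mul 2), integral_const_mul, he1, he2])
    (by push_cast; rw [integral_add hi1 (integrable_const 1), he1]; simp)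
    (by positivity)
  rw [NNReal.coe_mul] at h1 h2 h3
  refine ⟨hτ, h1.trans (congrArg _ ?_), h2.trans (congrArg _ ?_), h3.trans (congrArg _ ?_)⟩
  · field_simp
  · field_simp
    ring
  · have : (0 : ℝ) < 1 + lam * T := by positivity
    rw [add_comm ((lam : ℝ) * T) 1]
    field_simp
    ring

theorem policyHP2_means (hN : IsPoissonProcess N lam P) (hlam : 0 < lam) {q : ℕ} (hq : 1 ≤ q)
    (T : ℝ≥0) :
    IsStoppingTime hN.filtration (policyHP2 N q T) ∧
    meanWaiting P N (policyHP2 N q T) = ENNReal.ofReal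
      (truncPoissonMean (lam * T) (q - 1) (fun y => y * (y + 1)) / (2 * (lam : ℝ))) ∧
    meanCycle P (policyHP2 N q T)
      = ENNReal.ofReal (truncPoissonMean (lam * T) (q - 1) (fun y => y + 1) / (lam : ℝ)) ∧
    averageOrderDelay P N (policyHP2 N q T) = ENNReal.ofReal
      (truncPoissonMean (lam * T) (q - 1) (fun y => y * (y + 1)) / (2 * (lam : ℝ))
        / truncPoissonMean (lam * T) (q - 1) (fun y => y + 1)) := by
  have hτ1 := hN.isStoppingTime_arrivalTime 1
  have hτ : IsStoppingTime hN.filtration (policyHP2 N q T) :=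
    IsStoppingTime.min (hN.isStoppingTime_arrivalTime q) (hτ1.add_coe T)
  have hfin1 := hN.ae_arrivalTime_ne_top hlam le_rfl
  have hfin : ∀ᵐ ω ∂P, policyHP2 N q T ω ≠ ∞ := by
    filter_upwards [hfin1] with ω hω
    exact ((min_le_right _ _).trans_lt (ENNReal.add_lt_top.2 ⟨hω.lt_top, ENNReal.coe_lt_top⟩)).ne
  -- One order has arrived at `τ_1`, so the cap `q` on the total caps the later increment at `q -
  -- 1`.
  have hval : ∀ᵐ ω ∂P, N (policyHP2 N q T ω).toNNReal ω
      = min (N ((arrivalTime N 1 ω).toNNReal + T) ω - N (arrivalTime N 1 ω).toNNReal ω)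
        (q - 1) + 1 := by
    filter_upwards [hfin1, hN.ae_natCast_arrivalTime] with ω h1 h2
    have h3 := hN.mono ω (le_self_add (a := (arrivalTime N 1 ω).toNNReal) (b := T))
    simp only at h3
    rw [h2 1 le_rfl h1] at h3 ⊢
    have hc : arrivalTime N 1 ω + (T : ℝ≥0∞)
        = (((arrivalTime N 1 ω).toNNReal + T : ℝ≥0) : ℝ≥0∞) := by
      rw [ENNReal.coe_add, ENNReal.coe_toNNReal h1]
    rw [policyHP2, hc]
    rcases le_or_gt (arrivalTime N q ω) (((arrivalTime N 1 ω).toNNReal + T : ℝ≥0) : ℝ≥0∞) with h | h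
    · have h4 := (hN.arrivalTime_le_iff q _ ω).1 h
      rw [min_eq_left h, h2 q hq (h.trans_lt ENNReal.coe_lt_top).ne]
      omega
    · rw [min_eq_right h.le, ENNReal.toNNReal_coe]
      rw [← not_le, hN.arrivalTime_le_iff] at h
      omega
  have e : ∀ n : ℕ, ((n + 1 : ℕ) : ℝ) * (((n + 1 : ℕ) : ℝ) - 1) = (n : ℝ) * (n + 1) := fun n => by
    push_cast
    ring
  refine ⟨hτ, hN.policy_means hlam hτ hfin (hN.hasLaw_increment_stoppingTime hτ1 hfin1 T)
    (f := fun n => min n (q - 1) + 1) hval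
    (integrable_min_natCast_poissonMeasure _ (q - 1) fun n => ((n + 1 : ℕ) : ℝ))
    (integrable_min_natCast_poissonMeasure _ (q - 1) fun n => ((n + 1 : ℕ) : ℝ) * (((n + 1 : ℕ) : ℝ) - 1))
    (by simp only [e]; rfl) (by simp only [Nat.cast_add, Nat.cast_one]; rfl) ?_⟩
  rw [truncPoissonMean, integral_add (integrable_min_natCast_poissonMeasure _ (q - 1) fun n => n)
    (integrable_const 1)]
  have h0 : 0 ≤ ∫ n, ((min n (q - 1) : ℕ) : ℝ) ∂(poissonMeasure (lam * T)) :=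
    integral_nonneg fun n => Nat.cast_nonneg _
  simp only [integral_const, probReal_univ, smul_eq_mul, mul_one]
  linarith

end IsPoissonProcess

end

theorem mainTheorem2 {Ω : Type*} [MeasurableSpace Ω] {P : Measure Ω} [IsProbabilityMeasure P]
    {lam : ℝ≥0} (hlam : 0 < lam) {N : ℝ≥0 → Ω → ℕ} (hN : IsPoissonProcess N lam P) :
    -- the martingale
    Martingale
      (fun (t : ℝ≥0) (ω : Ω) => cumulativeWaiting N t ω
        - (N t ω : ℝ) ^ 2 / (2 * (lam : ℝ)) + (N t ω : ℝ) / (2 * (lam : ℝ)))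
      hN.filtration P ∧
    -- stopping times with finite mean, and the unified formula
    (∀ τ : Ω → ℝ≥0∞, IsStoppingTime hN.filtration τ → meanCycle P τ < ∞ →
      meanWaiting P N τ = meanOrdersSqSub P N τ / (2 * (lam : ℝ≥0∞)) ∧
      meanCycle P τ = meanOrders P N τ / (lam : ℝ≥0∞) ∧
      (0 < meanCycle P τ →
        averageOrderDelay P N τ = meanWaiting P N τ / ((lam : ℝ≥0∞) * meanCycle P τ) ∧
        averageOrderDelay P N τ
          = meanOrdersSqSub P N τ / (2 * (lam : ℝ≥0∞)) / meanOrders P N τ)) ∧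
    -- QP
    (∀ q : ℕ, 1 ≤ q →
      IsStoppingTime hN.filtration (policyQP N q) ∧
      meanWaiting P N (policyQP N q)
        = ENNReal.ofReal ((q : ℝ) * ((q : ℝ) - 1) / (2 * (lam : ℝ))) ∧
      meanCycle P (policyQP N q) = ENNReal.ofReal ((q : ℝ) / (lam : ℝ)) ∧
      averageOrderDelay P N (policyQP N q)
        = ENNReal.ofReal (((q : ℝ) - 1) / (2 * (lam : ℝ)))) ∧
    -- TP1
    (∀ T : ℝ≥0, 0 < T →
      IsStoppingTime hN.filtration (policyTP1 Ω T) ∧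
      meanWaiting P N (policyTP1 Ω T) = ENNReal.ofReal ((lam : ℝ) * (T : ℝ) ^ 2 / 2) ∧
      meanCycle P (policyTP1 Ω T) = ENNReal.ofReal (T : ℝ) ∧
      averageOrderDelay P N (policyTP1 Ω T) = ENNReal.ofReal ((T : ℝ) / 2)) ∧
    -- TP2
    (∀ T : ℝ≥0, 0 < T →
      IsStoppingTime hN.filtration (policyTP2 N T) ∧
      meanWaiting P N (policyTP2 N T)
        = ENNReal.ofReal ((lam : ℝ) * (T : ℝ) ^ 2 / 2 + (T : ℝ)) ∧
      meanCycle P (policyTP2 N T) = ENNReal.ofReal (1 / (lam : ℝ) + (T : ℝ)) ∧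
      averageOrderDelay P N (policyTP2 N T)
        = ENNReal.ofReal (((T : ℝ) + (lam : ℝ) * (T : ℝ) ^ 2 / 2) / (1 + (lam : ℝ) * (T : ℝ)))) ∧
    -- HP1
    (∀ (q : ℕ) (T : ℝ≥0), 1 ≤ q → 0 < T →
      IsStoppingTime hN.filtration (policyHP1 N q T) ∧
      meanWaiting P N (policyHP1 N q T)
        = ENNReal.ofReal
            (truncPoissonMean (lam * T) q (fun y => y * (y - 1)) / (2 * (lam : ℝ))) ∧
      meanCycle P (policyHP1 N q T)
        = ENNReal.ofReal (truncPoissonMean (lam * T) q (fun y => y) / (lam : ℝ)) ∧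
      averageOrderDelay P N (policyHP1 N q T)
        = ENNReal.ofReal
            (truncPoissonMean (lam * T) q (fun y => y * (y - 1)) / (2 * (lam : ℝ))
              / truncPoissonMean (lam * T) q (fun y => y))) ∧
    -- HP2
    (∀ (q : ℕ) (T : ℝ≥0), 1 ≤ q → 0 < T →
      IsStoppingTime hN.filtration (policyHP2 N q T) ∧
      meanWaiting P N (policyHP2 N q T)
        = ENNReal.ofReal
            (truncPoissonMean (lam * T) (q - 1) (fun y => y * (y + 1)) / (2 * (lam : ℝ))) ∧
      meanCycle P (policyHP2 N q T)
        = ENNReal.ofReal (truncPoissonMean (lam * T) (q - 1) (fun y => y + 1) / (lam : ℝ)) ∧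
      averageOrderDelay P N (policyHP2 N q T)
        = ENNReal.ofReal
            (truncPoissonMean (lam * T) (q - 1) (fun y => y * (y + 1)) / (2 * (lam : ℝ))
              / truncPoissonMean (lam * T) (q - 1) (fun y => y + 1))) := by
  refine ⟨hN.martingale_cumulativeWaiting hlam, fun τ hτ hmean => ?_,
    fun q hq => hN.policyQP_means hlam hq, fun T hT => hN.policyTP1_means hlam hT,
    fun T _ => hN.policyTP2_means hlam T, fun q T hq hT => hN.policyHP1_means hlam hq hT,
    fun q T hq _ => hN.policyHP2_means hlam hq T⟩
  -- The finite mean enters through almost sure finiteness, which is all that the limiting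
  -- identities need.
  have hfin : ∀ᵐ ω ∂P, τ ω ≠ ∞ := by
    filter_upwards [ae_lt_top hτ.measurable_ennreal hmean.ne] with ω hω using hω.ne
  refine ⟨hN.meanWaiting_eq hlam hτ hfin, hN.meanCycle_eq hlam hτ hfin, fun _ => ⟨?_, ?_⟩⟩
  · rw [averageOrderDelay, hN.meanOrders_eq hτ hfin]
  · rw [averageOrderDelay, hN.meanWaiting_eq hlam hτ hfin]
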